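/- **Theorem (Fundamental Property).** For all $\Gamma_H,\Gamma_L,e,\tau$ (notation below): if $\Gamma_H;\Gamma_L\vdash e:\tau$ for a RefLL expression $e$, then $[\![\Gamma_H;\Gamma_L\vdash e:\tau]\!]$; and if $\Gamma_L;\Gamma_H\vdash e:\tau$ for a RefHL expression $e$, then $[\![\Gamma_L;\Gamma_H\vdash e:\tau]\!]$. *Target language.* Programs $P$ are finite sequences of instructions (written with commas, $\cdot$ is empty), values are $v::=n\in\mathbb Z\mid \mathsf{thunk}\,P\mid \ell\mid[v,\dots,v]$, and instructions are $\mathsf{push}\,v$, $\mathsf{add}$, $\mathsf{less?}$, $\mathsf{if0}\,P\,P$, $\mathsf{lam}\,x.P$, $\mathsf{call}$, $\mathsf{idx}$, $\mathsf{len}$, $\mathsf{alloc}$, $\mathsf{read}$, $\mathsf{write}$, $\mathsf{fail}\,c$ with $c\in\{\textsc{Type},\textsc{Idx},\textsc{Conv}\}$. Under $\mathsf{lam}\,x$ values may contain $x$; $\mathsf{lam}\,x_n,\dots,x_1.P$ is iterated $\mathsf{lam}$. A heap $H$ is a finite map from locations to values; a stack $S$ is a list of values (top on the right) or $\mathsf{Fail}\,c$.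 The steps are - $\langle H;S;\mathsf{push}\,v,P\rangle\to\langle H;S,v;P\rangle$ for $S\ne\mathsf{Fail}\,c$; - $\langle H;S,n',n;\mathsf{add},P\rangle\to\langle H;S,n+n';P\rangle$; $\langle H;S,n',n;\mathsf{less?},P\rangle\to\langle H;S,b;P\rangle$ with $b=0$ if $n<n'$, else $b=1$; - $\langle H;S,n;\mathsf{if0}\,P_1\,P_2,P\rangle\to\langle H;S;P_i,P\rangle$ with $i=1$ if $n=0$, else $i=2$; - $\langle H;S,v;\mathsf{lam}\,x.P_1,P_2\rangle\to\langle H;S;[x\mapsto v]P_1,P_2\rangle$; $\langle H;S,\mathsf{thunk}\,P_1;\mathsf{call},P_2\rangle\to\langle H;S;P_1,P_2\rangle$; - $\langle H;S,[v_0,\dots,v_{m-1}],n;\mathsf{idx},P\rangle\to\langle H;S,v_n;P\rangle$ if $0\le n<m$, and $\to\langle H;S;\mathsf{fail}\,\textsc{Idx}\rangle$ otherwise; $\langle H;S,[v_0,\dots,v_{m-1}];\mathsf{len},P\rangle\to\langle H;S,m;P\rangle$; - $\langle H;S,v;\mathsf{alloc},P\rangle\to\langle H\uplus\{\ell:v\};S,\ell;P\rangle$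 for any $\ell\notin\mathrm{dom}\,H$; $\langle H;S,\ell;\mathsf{read},P\rangle\to\langle H;S,H(\ell);P\rangle$ and $\langle H;S,\ell,v;\mathsf{write},P\rangle\to\langle H[\ell\mapsto v];S;P\rangle$ for $\ell\in\mathrm{dom}\,H$; - $\langle H;S;\mathsf{fail}\,c,P\rangle\to\langle H;\mathsf{Fail}\,c;\cdot\rangle$; and $\langle H;S;i,P\rangle\to\langle H;S;\mathsf{fail}\,\textsc{Type}\rangle$ whenever no rule above applies to $\langle H;S;i,P\rangle$. $\overset{j}{\to}$ means exactly $j$ steps. *Source languages.* RefHL is the simply typed $\lambda$-calculus with types $\mathtt{unit},\mathtt{bool},\tau+\tau,\tau\times\tau,\tau\to\tau,\mathtt{ref}\,\tau$ and expressions $()$, $\mathtt{true}$, $\mathtt{false}$, $x$, $\mathtt{inl}\,e$, $\mathtt{inr}\,e$, $(e,e)$, $\mathtt{fst}\,e$, $\mathtt{snd}\,e$, $\mathtt{if}\,e\,e\,e$, $\lambda x{:}\tau.e$, $e\,e$, $\mathtt{match}\,e\,x\{e\}\,y\{e\}$, $\mathtt{ref}\,e$, $!e$, $e:=e$ and the boundary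 $(\!|e|\!)_\tau$ around a RefLL expression. RefLL has types $\mathtt{int},[\tau],\tau\to\tau,\mathtt{ref}\,\tau$ and expressions $n\in\mathbb Z$, $x$, $[e_1,\dots,e_n]$ ($n\ge0$), $e[e]$, $\lambda x{:}\tau.e$, $e\,e$, $e+e$, $\mathtt{if0}\,e\,e\,e$, $\mathtt{ref}\,e$, $!e$, $e:=e$ and the boundary $(\!|e|\!)_\tau$ around a RefHL expression. The variables of the two languages are disjoint. Typing $\Gamma_L;\Gamma_H\vdash e:\tau$ (RefHL) and $\Gamma_H;\Gamma_L\vdash e:\tau$ (RefLL) uses the standard rules, each language extending and looking up its own environment (assignments have type $\mathtt{unit}$ in RefHL, $\mathtt{int}$ in RefLL), and the boundary rules: if $\Gamma_H;\Gamma_L\vdash e:\tau_B$ and $\tau_A\sim\tau_B$, then $\Gamma_L;\Gamma_H\vdash(\!|e|\!)_{\tau_A}:\tau_A$; if $\Gamma_L;\Gamma_H\vdash e:\tau_A$ and $\tau_A\sim\tau_B$, then $\Gamma_H;\Gamma_L\vdash(\!|e|\!)_{\tau_B}:\tau_B$. *Convertibility* (RefHL type $\sim$ RefLL type) is generated by: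 $\mathtt{bool}\sim\mathtt{int}$; $\mathtt{ref\,bool}\sim\mathtt{ref\,int}$; $\tau_1+\tau_2\sim[\mathtt{int}]$ if $\tau_1\sim\mathtt{int}$ and $\tau_2\sim\mathtt{int}$; $\tau_1\times\tau_2\sim[\tau]$ if $\tau_1\sim\tau$ and $\tau_2\sim\tau$. Let $\mathsf{SWAP}=\mathsf{lam}\,x.(\mathsf{lam}\,y.(\mathsf{push}\,x,\mathsf{push}\,y))$, $\mathsf{DUP}=\mathsf{lam}\,x.(\mathsf{push}\,x,\mathsf{push}\,x)$, $\mathsf{PACK}_n=\mathsf{lam}\,x_n,\dots,x_1.\mathsf{push}\,[x_1,\dots,x_n]$ (so $\mathsf{PACK}_0=\mathsf{push}\,[\,]$), $\mathsf{SPLIT}=\mathsf{DUP},\mathsf{push}\,1,\mathsf{idx},\mathsf{SWAP},\mathsf{push}\,0,\mathsf{idx}$, $\mathsf{CHECK}=\mathsf{DUP},\mathsf{len},\mathsf{push}\,2,\mathsf{SWAP},\mathsf{less?},\mathsf{if0}\,(\mathsf{fail}\,\textsc{Conv})\,(\cdot)$. The conversion code is empty for the first two rules and otherwise - $C_{\tau_1+\tau_2\mapsto[\mathtt{int}]}=\mathsf{SPLIT},\mathsf{DUP},\mathsf{if0}\,(\mathsf{SWAP},C_{\tau_1\mapsto\mathtt{int}})\,(\mathsf{SWAP},C_{\tau_2\mapsto\mathtt{int}}),\mathsf{PACK}_2$;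 - $C_{[\mathtt{int}]\mapsto\tau_1+\tau_2}=\mathsf{CHECK},\mathsf{SPLIT},\mathsf{DUP},\mathsf{if0}\,(\mathsf{SWAP},C_{\mathtt{int}\mapsto\tau_1})\,(\mathsf{DUP},\mathsf{push}\,{-1},\mathsf{add},\mathsf{if0}\,(\mathsf{SWAP},C_{\mathtt{int}\mapsto\tau_2})\,(\mathsf{fail}\,\textsc{Conv})),\mathsf{PACK}_2$; - $C_{\tau_1\times\tau_2\mapsto[\tau]}=\mathsf{DUP},\mathsf{push}\,0,\mathsf{idx},C_{\tau_1\mapsto\tau},\mathsf{SWAP},\mathsf{push}\,1,\mathsf{idx},C_{\tau_2\mapsto\tau},\mathsf{PACK}_2$, and $C_{[\tau]\mapsto\tau_1\times\tau_2}$ is $\mathsf{CHECK}$ followed by the same code with $C_{\tau\mapsto\tau_i}$ for $C_{\tau_i\mapsto\tau}$. *Compilation* $e^+$ is defined by recursion on the typing derivation (boundary code depends on both types). RefHL: $()^+=\mathtt{true}^+=\mathsf{push}\,0$; $\mathtt{false}^+=\mathsf{push}\,1$; $(\mathtt{inl}\,e)^+,(\mathtt{inr}\,e)^+=e^+,\mathsf{lam}\,x.\mathsf{push}\,[t,x]$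 with $t=0$, resp. $1$; $(e_1,e_2)^+=e_1^+,e_2^+,\mathsf{PACK}_2$; $(\mathtt{fst}\,e)^+,(\mathtt{snd}\,e)^+=e^+,\mathsf{push}\,t,\mathsf{idx}$ with $t=0$, resp. $1$; $(\mathtt{if}\,e\,e_1\,e_2)^+=e^+,\mathsf{if0}\,e_1^+\,e_2^+$; $(\mathtt{match}\,e\,x\{e_1\}\,y\{e_2\})^+=e^+,\mathsf{SPLIT},\mathsf{if0}\,(\mathsf{lam}\,x.e_1^+)\,(\mathsf{lam}\,y.e_2^+)$. RefLL: $n^+=\mathsf{push}\,n$; $[e_1,\dots,e_n]^+=e_1^+,\dots,e_n^+,\mathsf{PACK}_n$; $(e_1[e_2])^+=e_1^+,e_2^+,\mathsf{idx}$; $(e_1+e_2)^+=e_1^+,e_2^+,\mathsf{SWAP},\mathsf{add}$; $(\mathtt{if0}\,e\,e_1\,e_2)^+=e^+,\mathsf{if0}\,e_1^+\,e_2^+$. Both: $x^+=\mathsf{push}\,x$; $(\lambda x{:}\tau.e)^+=\mathsf{push}\,(\mathsf{thunk}\,\mathsf{lam}\,x.e^+)$; $(e_1\,e_2)^+=e_1^+,e_2^+,\mathsf{SWAP},\mathsf{call}$;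 $(\mathtt{ref}\,e)^+=e^+,\mathsf{alloc}$; $(!e)^+=e^+,\mathsf{read}$; $(e_1:=e_2)^+=e_1^+,e_2^+,\mathsf{write},\mathsf{push}\,0$; $(\!|e|\!)_{\tau}^+=e^+,C_{\tau'\mapsto\tau}$ for $e:\tau'$. *Worlds.* By recursion on $n$: $World_n$ is the set of pairs $W=(k,\Psi)$ with $k<n$ and $\Psi$ a finite map from locations to $Typ_k$; $Typ_n$ is the set of those sets $R$ of pairs $(W,v)$, $W\in World_n$, $v$ a closed value, such that $(W,v)\in R$ and $W\sqsubseteq W'$ imply $(W',v)\in R$. Here $(k,\Psi)\sqsubseteq(j,\Psi')$ means $j\le k$ and $\Psi'(\ell)=\lfloor\Psi(\ell)\rfloor_j$ for all $\ell\in\mathrm{dom}\,\Psi$, where $\lfloor R\rfloor_j=\{(W,v)\in R: W\in World_j\}$; $W\sqsubset W'$ means in addition $W'.k<W.k$. A world is an element of some $World_n$. $H:W$ means that for all $\ell\in\mathrm{dom}\,W.\Psi$, $H(\ell)$ is defined and $(W',H(\ell))\in W.\Psi(\ell)$ for all $W'\sqsupset W$. *Logical relation.* $$\mathcal E[\![\tau]\!]=\{(W,P):\forall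 H{:}W,\ S\ne\mathsf{Fail}\,\_,\ H',S',\ j<W.k.\ \langle H;S;P\rangle\overset{j}{\to}\langle H';S';\cdot\rangle\Rightarrow S'\in\{\mathsf{Fail}\,\textsc{Conv},\mathsf{Fail}\,\textsc{Idx}\}\ \lor$$ $$\exists v,\ W'\sqsupseteq W.\ W'.k=W.k-j\ \land\ S'=S,v\ \land\ H':W'\ \land\ (W',v)\in\mathcal V[\![\tau]\!]\},$$ and $\mathcal V[\![\tau]\!]$ is a set of pairs of a world and a closed value: - $\mathcal V[\![\mathtt{unit}]\!]=\{(W,0)\}$, $\mathcal V[\![\mathtt{bool}]\!]=\mathcal V[\![\mathtt{int}]\!]=\{(W,n):n\in\mathbb Z\}$; - $\mathcal V[\![\tau_1+\tau_2]\!]=\{(W,[0,v]):(W,v)\in\mathcal V[\![\tau_1]\!]\}\cup\{(W,[1,v]):(W,v)\in\mathcal V[\![\tau_2]\!]\}$; - $\mathcal V[\![\tau_1\times\tau_2]\!]=\{(W,[v_1,v_2]):(W,v_i)\in\mathcal V[\![\tau_i]\!]\}$, $\mathcal V[\![[\tau]]\!]=\{(W,[v_1,\dots,v_n]):(W,v_i)\in\mathcal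 V[\![\tau]\!]\}$; - $\mathcal V[\![\tau_1\to\tau_2]\!]=\{(W,\mathsf{thunk}\,\mathsf{lam}\,x.P):\forall v,W'\sqsupset W.\ (W',v)\in\mathcal V[\![\tau_1]\!]\Rightarrow(W',[x\mapsto v]P)\in\mathcal E[\![\tau_2]\!]\}$; - $\mathcal V[\![\mathtt{ref}\,\tau]\!]=\{(W,\ell):W.\Psi(\ell)=\lfloor\mathcal V[\![\tau]\!]\rfloor_{W.k}\}$. $(W,\gamma)\in\mathcal G[\![\Gamma]\!]$ means that $\gamma$ maps exactly the variables of $\Gamma$ to values, with $(W,\gamma(x))\in\mathcal V[\![\tau]\!]$ whenever $\Gamma(x)=\tau$; $\mathrm{close}(\gamma,P)$ substitutes $\gamma$ in $P$. Finally, $[\![\Gamma_H;\Gamma_L\vdash e:\tau]\!]$ means that for all $W,\gamma_H,\gamma_L$ with $(W,\gamma_H)\in\mathcal G[\![\Gamma_H]\!]$ and $(W,\gamma_L)\in\mathcal G[\![\Gamma_L]\!]$, $(W,\mathrm{close}(\gamma_H,\mathrm{close}(\gamma_L,e^+)))\in\mathcal E[\![\tau]\!]$; and $[\![\Gamma_L;\Gamma_H\vdash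 e:\tau]\!]$ is the same with $\mathrm{close}(\gamma_L,\mathrm{close}(\gamma_H,e^+))$. -/

import Mathlib

namespace RefInterop

/-! ## The target language StackLang -/

/-- Heap locations. -/
abbrev Loc := ℕ

/-- Target variables.  The variables of the two source languages are compiled to two disjoint
families of target variables; `tmp` are the names used by compiler generated binders. -/
inductive TVar where
  | hl (x : ℕ)
  | ll (x : ℕ)
  | tmp (i : ℕ)
  deriving DecidableEq

/-- Error codes. -/
inductive Code where
  | type
  | idx
  | conv

mutual
  /-- Target values.  As instructions `push x` mention variables, variables are included here;
  a genuine (run-time) value is one without free variables, see `Val.Closed`. -/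
  inductive Val where
    | num (n : ℤ)
    | thunk (P : List Instr)
    | loc (l : Loc)
    | arr (vs : List Val)
    | var (x : TVar)
  /-- Target instructions. -/
  inductive Instr where
    | push (v : Val)
    | add
    | less
    | if0 (P₁ P₂ : List Instr)
    | lam (x : TVar) (P : List Instr)
    | call
    | idx
    | len
    | alloc
    | read
    | write
    | fail (c : Code)
end

/-- A program is a finite sequence of instructions. -/
abbrev Prog := List Instr

mutual
  /-- Free variables of a value. -/
  def Val.fv : Val → Set TVar
    | .num _ => ∅
    | .thunk P => progFv P
    | .loc _ => ∅
    | .arr vs => valsFv vs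
    | .var x => {x}
  /-- Free variables of an instruction; `lam x.P` binds `x` in `P`. -/
  def Instr.fv : Instr → Set TVar
    | .push v => v.fv
    | .if0 P₁ P₂ => progFv P₁ ∪ progFv P₂
    | .lam x P => progFv P \ {x}
    | .add => ∅
    | .less => ∅
    | .call => ∅
    | .idx => ∅
    | .len => ∅
    | .alloc => ∅
    | .read => ∅
    | .write => ∅
    | .fail _ => ∅
  /-- Free variables of a program. -/
  def progFv : List Instr → Set TVar
    | [] => ∅
    | i :: P => i.fv ∪ progFv P
  /-- Free variables of a list of values. -/
  def valsFv : List Val → Set TVar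
    | [] => ∅
    | v :: vs => v.fv ∪ valsFv vs
end

/-- A value without free variables. -/
def Val.Closed (v : Val) : Prop := v.fv = ∅

mutual
  /-- Simultaneous substitution in a value.  Only closed values are ever substituted, so there is
  no capture. -/
  def Val.subst (σ : TVar → Option Val) : Val → Val
    | .num n => .num n
    | .thunk P => .thunk (progSubst σ P)
    | .loc l => .loc l
    | .arr vs => .arr (valsSubst σ vs)
    | .var x => (σ x).getD (.var x)
  /-- Simultaneous substitution in an instruction; below `lam x` the variable `x` is shadowed. -/
  def Instr.subst (σ : TVar → Option Val) : Instr → Instr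
    | .push v => .push (v.subst σ)
    | .if0 P₁ P₂ => .if0 (progSubst σ P₁) (progSubst σ P₂)
    | .lam x P => .lam x (progSubst (fun y => if y = x then none else σ y) P)
    | .add => .add
    | .less => .less
    | .call => .call
    | .idx => .idx
    | .len => .len
    | .alloc => .alloc
    | .read => .read
    | .write => .write
    | .fail c => .fail c
  /-- Simultaneous substitution in a program. -/
  def progSubst (σ : TVar → Option Val) : List Instr → List Instr
    | [] => []
    | i :: P => i.subst σ :: progSubst σ P
  /-- Simultaneous substitution in a list of values. -/
  def valsSubst (σ : TVar → Option Val) : List Val → List Val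
    | [] => []
    | v :: vs => v.subst σ :: valsSubst σ vs
end

/-- `[x ↦ v]P`. -/
def progSubst1 (x : TVar) (v : Val) (P : Prog) : Prog :=
  progSubst (fun y => if y = x then some v else none) P

/-- Heaps are finite maps from locations to values. -/
abbrev Heap := Finmap (fun _ : Loc => Val)

/-- A stack is a list of values, with the top of the stack at the head of the list, or `Fail c`. -/
inductive Stack where
  | vals (S : List Val)
  | fail (c : Code)

/-- Machine configurations `⟨H; S; P⟩`. -/
structure Config where
  heap : Heap
  stack : Stack
  prog : Prog

/-- The reduction rules, except those that raise a dynamic type error. -/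
inductive Red : Config → Config → Prop
  | push (H : Heap) (S : List Val) (v : Val) (P : Prog) :
      Red ⟨H, .vals S, .push v :: P⟩ ⟨H, .vals (v :: S), P⟩
  | add (H : Heap) (S : List Val) (n n' : ℤ) (P : Prog) :
      Red ⟨H, .vals (.num n :: .num n' :: S), .add :: P⟩ ⟨H, .vals (.num (n + n') :: S), P⟩
  | less (H : Heap) (S : List Val) (n n' : ℤ) (P : Prog) :
      Red ⟨H, .vals (.num n :: .num n' :: S), .less :: P⟩
        ⟨H, .vals (.num (if n < n' then 0 else 1) :: S), P⟩
  | if0 (H : Heap) (S : List Val) (n : ℤ) (P₁ P₂ P : Prog) :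
      Red ⟨H, .vals (.num n :: S), .if0 P₁ P₂ :: P⟩
        ⟨H, .vals S, (if n = 0 then P₁ else P₂) ++ P⟩
  | lam (H : Heap) (S : List Val) (v : Val) (x : TVar) (P₁ P₂ : Prog) :
      Red ⟨H, .vals (v :: S), .lam x P₁ :: P₂⟩ ⟨H, .vals S, progSubst1 x v P₁ ++ P₂⟩
  | call (H : Heap) (S : List Val) (P₁ P₂ : Prog) :
      Red ⟨H, .vals (.thunk P₁ :: S), .call :: P₂⟩ ⟨H, .vals S, P₁ ++ P₂⟩
  | idx (H : Heap) (S : List Val) (vs : List Val) (n : ℕ) (v : Val) (P : Prog) :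
      vs[n]? = some v →
      Red ⟨H, .vals (.num (n : ℤ) :: .arr vs :: S), .idx :: P⟩ ⟨H, .vals (v :: S), P⟩
  | idxFail (H : Heap) (S : List Val) (vs : List Val) (n : ℤ) (P : Prog) :
      ¬ (0 ≤ n ∧ n < (vs.length : ℤ)) →
      Red ⟨H, .vals (.num n :: .arr vs :: S), .idx :: P⟩ ⟨H, .vals S, [.fail .idx]⟩
  | len (H : Heap) (S : List Val) (vs : List Val) (P : Prog) :
      Red ⟨H, .vals (.arr vs :: S), .len :: P⟩ ⟨H, .vals (.num (vs.length : ℤ) :: S), P⟩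
  | alloc (H : Heap) (S : List Val) (v : Val) (l : Loc) (P : Prog) :
      l ∉ H →
      Red ⟨H, .vals (v :: S), .alloc :: P⟩ ⟨H.insert l v, .vals (.loc l :: S), P⟩
  | read (H : Heap) (S : List Val) (l : Loc) (v : Val) (P : Prog) :
      H.lookup l = some v →
      Red ⟨H, .vals (.loc l :: S), .read :: P⟩ ⟨H, .vals (v :: S), P⟩
  | write (H : Heap) (S : List Val) (l : Loc) (v : Val) (P : Prog) :
      l ∈ H →
      Red ⟨H, .vals (v :: .loc l :: S), .write :: P⟩ ⟨H.insert l v, .vals S, P⟩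
  | fail (H : Heap) (S : Stack) (c : Code) (P : Prog) :
      Red ⟨H, S, .fail c :: P⟩ ⟨H, .fail c, []⟩

/-- One step of the machine.  Whenever the precondition of the next instruction is not met, the
machine steps to the program `fail Type`. -/
inductive Step : Config → Config → Prop
  | red {c c' : Config} : Red c c' → Step c c'
  | type (H : Heap) (S : Stack) (i : Instr) (P : Prog) :
      (∀ c', ¬ Red ⟨H, S, i :: P⟩ c') → Step ⟨H, S, i :: P⟩ ⟨H, S, [.fail .type]⟩

/-- `Steps j c c'`: the machine goes from `c` to `c'` in exactly `j` steps. -/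
inductive Steps : ℕ → Config → Config → Prop
  | refl (c : Config) : Steps 0 c c
  | head {j : ℕ} {c c' c'' : Config} : Step c c' → Steps j c' c'' → Steps (j + 1) c c''

/-! ## The source languages RefHL and RefLL -/

/-- RefHL types. -/
inductive HTy where
  | unit
  | bool
  | sum (τ₁ τ₂ : HTy)
  | prod (τ₁ τ₂ : HTy)
  | fn (τ₁ τ₂ : HTy)
  | ref (τ : HTy)

/-- RefLL types. -/
inductive LTy where
  | int
  | arr (τ : LTy)
  | fn (τ₁ τ₂ : LTy)
  | ref (τ : LTy)

mutual
  /-- RefHL expressions. -/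
  inductive HExp where
    | unit
    | true
    | false
    | var (x : ℕ)
    | inl (e : HExp)
    | inr (e : HExp)
    | pair (e₁ e₂ : HExp)
    | fst (e : HExp)
    | snd (e : HExp)
    | ite (e e₁ e₂ : HExp)
    | lam (x : ℕ) (τ : HTy) (e : HExp)
    | app (e₁ e₂ : HExp)
    | case (e : HExp) (x : ℕ) (e₁ : HExp) (y : ℕ) (e₂ : HExp)
    | ref (e : HExp)
    | deref (e : HExp)
    | assign (e₁ e₂ : HExp)
    /-- The boundary `⦇e⦈_τ` around a RefLL expression. -/
    | boundary (τ : HTy) (e : LExp)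
  /-- RefLL expressions. -/
  inductive LExp where
    | num (n : ℤ)
    | var (x : ℕ)
    | arr (es : List LExp)
    | index (e₁ e₂ : LExp)
    | lam (x : ℕ) (τ : LTy) (e : LExp)
    | app (e₁ e₂ : LExp)
    | add (e₁ e₂ : LExp)
    | if0 (e e₁ e₂ : LExp)
    | ref (e : LExp)
    | deref (e : LExp)
    | assign (e₁ e₂ : LExp)
    /-- The boundary `⦇e⦈_τ` around a RefHL expression. -/
    | boundary (τ : LTy) (e : HExp)
end

/-- Type environments; the most recent binding of a variable is the first one in the list. -/
abbrev Env (Ty : Type) := List (ℕ × Ty)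

/-- Derivations of the convertibility judgment `τ_A ∼ τ_B`. -/
inductive Conv : HTy → LTy → Type
  | bool : Conv .bool .int
  | refBool : Conv (.ref .bool) (.ref .int)
  | sum {τ₁ τ₂ : HTy} : Conv τ₁ .int → Conv τ₂ .int → Conv (.sum τ₁ τ₂) (.arr .int)
  | prod {τ₁ τ₂ : HTy} {τ : LTy} : Conv τ₁ τ → Conv τ₂ τ → Conv (.prod τ₁ τ₂) (.arr τ)

mutual
  /-- Typing derivations `Γ_L; Γ_H ⊢ e : τ` of RefHL. -/
  inductive HTyping : Env LTy → Env HTy → HExp → HTy → Type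
    | unit {ΓL ΓH} : HTyping ΓL ΓH .unit .unit
    | true {ΓL ΓH} : HTyping ΓL ΓH .true .bool
    | false {ΓL ΓH} : HTyping ΓL ΓH .false .bool
    | var {ΓL ΓH} {x : ℕ} {τ : HTy} : ΓH.lookup x = some τ → HTyping ΓL ΓH (.var x) τ
    | inl {ΓL ΓH e τ₁ τ₂} : HTyping ΓL ΓH e τ₁ → HTyping ΓL ΓH (.inl e) (.sum τ₁ τ₂)
    | inr {ΓL ΓH e τ₁ τ₂} : HTyping ΓL ΓH e τ₂ → HTyping ΓL ΓH (.inr e) (.sum τ₁ τ₂)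
    | pair {ΓL ΓH e₁ e₂ τ₁ τ₂} : HTyping ΓL ΓH e₁ τ₁ → HTyping ΓL ΓH e₂ τ₂ →
        HTyping ΓL ΓH (.pair e₁ e₂) (.prod τ₁ τ₂)
    | fst {ΓL ΓH e τ₁ τ₂} : HTyping ΓL ΓH e (.prod τ₁ τ₂) → HTyping ΓL ΓH (.fst e) τ₁
    | snd {ΓL ΓH e τ₁ τ₂} : HTyping ΓL ΓH e (.prod τ₁ τ₂) → HTyping ΓL ΓH (.snd e) τ₂
    | ite {ΓL ΓH e e₁ e₂ τ} : HTyping ΓL ΓH e .bool → HTyping ΓL ΓH e₁ τ →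
        HTyping ΓL ΓH e₂ τ → HTyping ΓL ΓH (.ite e e₁ e₂) τ
    | lam {ΓL ΓH x e τ₁ τ₂} : HTyping ΓL ((x, τ₁) :: ΓH) e τ₂ →
        HTyping ΓL ΓH (.lam x τ₁ e) (.fn τ₁ τ₂)
    | app {ΓL ΓH e₁ e₂ τ₁ τ₂} : HTyping ΓL ΓH e₁ (.fn τ₁ τ₂) → HTyping ΓL ΓH e₂ τ₁ →
        HTyping ΓL ΓH (.app e₁ e₂) τ₂
    | case {ΓL ΓH e x e₁ y e₂ τ₁ τ₂ τ} : HTyping ΓL ΓH e (.sum τ₁ τ₂) →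
        HTyping ΓL ((x, τ₁) :: ΓH) e₁ τ → HTyping ΓL ((y, τ₂) :: ΓH) e₂ τ →
        HTyping ΓL ΓH (.case e x e₁ y e₂) τ
    | ref {ΓL ΓH e τ} : HTyping ΓL ΓH e τ → HTyping ΓL ΓH (.ref e) (.ref τ)
    | deref {ΓL ΓH e τ} : HTyping ΓL ΓH e (.ref τ) → HTyping ΓL ΓH (.deref e) τ
    | assign {ΓL ΓH e₁ e₂ τ} : HTyping ΓL ΓH e₁ (.ref τ) → HTyping ΓL ΓH e₂ τ →
        HTyping ΓL ΓH (.assign e₁ e₂) .unit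
    | boundary {ΓL ΓH e τ τ'} : LTyping ΓH ΓL e τ' → Conv τ τ' →
        HTyping ΓL ΓH (.boundary τ e) τ
  /-- Typing derivations `Γ_H; Γ_L ⊢ e : τ` of RefLL. -/
  inductive LTyping : Env HTy → Env LTy → LExp → LTy → Type
    | num {ΓH ΓL} {n : ℤ} : LTyping ΓH ΓL (.num n) .int
    | var {ΓH ΓL} {x : ℕ} {τ : LTy} : ΓL.lookup x = some τ → LTyping ΓH ΓL (.var x) τ
    | arr {ΓH ΓL es τ} : LTypings ΓH ΓL es τ → LTyping ΓH ΓL (.arr es) (.arr τ)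
    | index {ΓH ΓL e₁ e₂ τ} : LTyping ΓH ΓL e₁ (.arr τ) → LTyping ΓH ΓL e₂ .int →
        LTyping ΓH ΓL (.index e₁ e₂) τ
    | lam {ΓH ΓL x e τ₁ τ₂} : LTyping ΓH ((x, τ₁) :: ΓL) e τ₂ →
        LTyping ΓH ΓL (.lam x τ₁ e) (.fn τ₁ τ₂)
    | app {ΓH ΓL e₁ e₂ τ₁ τ₂} : LTyping ΓH ΓL e₁ (.fn τ₁ τ₂) → LTyping ΓH ΓL e₂ τ₁ →
        LTyping ΓH ΓL (.app e₁ e₂) τ₂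
    | add {ΓH ΓL e₁ e₂} : LTyping ΓH ΓL e₁ .int → LTyping ΓH ΓL e₂ .int →
        LTyping ΓH ΓL (.add e₁ e₂) .int
    | if0 {ΓH ΓL e e₁ e₂ τ} : LTyping ΓH ΓL e .int → LTyping ΓH ΓL e₁ τ →
        LTyping ΓH ΓL e₂ τ → LTyping ΓH ΓL (.if0 e e₁ e₂) τ
    | ref {ΓH ΓL e τ} : LTyping ΓH ΓL e τ → LTyping ΓH ΓL (.ref e) (.ref τ)
    | deref {ΓH ΓL e τ} : LTyping ΓH ΓL e (.ref τ) → LTyping ΓH ΓL (.deref e) τ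
    | assign {ΓH ΓL e₁ e₂ τ} : LTyping ΓH ΓL e₁ (.ref τ) → LTyping ΓH ΓL e₂ τ →
        LTyping ΓH ΓL (.assign e₁ e₂) .int
    | boundary {ΓH ΓL e τ τ'} : HTyping ΓL ΓH e τ' → Conv τ' τ →
        LTyping ΓH ΓL (.boundary τ e) τ
  /-- Derivations that all expressions of a list have the RefLL type `τ`. -/
  inductive LTypings : Env HTy → Env LTy → List LExp → LTy → Type
    | nil {ΓH ΓL τ} : LTypings ΓH ΓL [] τ
    | cons {ΓH ΓL e es τ} : LTyping ΓH ΓL e τ → LTypings ΓH ΓL es τ →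
        LTypings ΓH ΓL (e :: es) τ
end

/-! ## Conversions and compilers -/

/-- `push n` for an integer `n`. -/
def pushNum (n : ℤ) : Instr := .push (.num n)

/-- `push x` for a compiler generated variable. -/
def pushTmp (i : ℕ) : Instr := .push (.var (.tmp i))

/-- `SWAP = lam x.(lam y.(push x, push y))`. -/
def SWAP : Instr := .lam (.tmp 0) [.lam (.tmp 1) [pushTmp 0, pushTmp 1]]

/-- `DUP = lam x.(push x, push x)`. -/
def DUP : Instr := .lam (.tmp 0) [pushTmp 0, pushTmp 0]

/-- `lam xₙ, …, x₁.P`, where `xᵢ` is the variable `tmp (i - 1)`. -/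
def lamTmps : ℕ → Prog → Prog
  | 0, P => P
  | n + 1, P => [.lam (.tmp n) (lamTmps n P)]

/-- `lam xₙ, …, x₁.(push [x₁, …, xₙ])`: pop `n` values and push the array of them. -/
def packArr (n : ℕ) : Prog :=
  lamTmps n [.push (.arr ((List.range n).map fun i => .var (.tmp i)))]

mutual
  /-- The conversion code `C_{τ_A ↦ τ_B}` from RefHL to RefLL. -/
  def Conv.toLL : {τ : HTy} → {τ' : LTy} → Conv τ τ' → Prog
    | _, _, .bool => []
    | _, _, .refBool => []
    | _, _, .sum c₁ c₂ =>
        [DUP, pushNum 1, .idx, SWAP, pushNum 0, .idx, DUP,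
          .if0 (SWAP :: c₁.toLL) (SWAP :: c₂.toLL)] ++ packArr 2
    | _, _, .prod c₁ c₂ =>
        [DUP, pushNum 0, .idx] ++ c₁.toLL ++ [SWAP, pushNum 1, .idx] ++ c₂.toLL ++ packArr 2
  /-- The conversion code `C_{τ_B ↦ τ_A}` from RefLL to RefHL. -/
  def Conv.toHL : {τ : HTy} → {τ' : LTy} → Conv τ τ' → Prog
    | _, _, .bool => []
    | _, _, .refBool => []
    | _, _, .sum c₁ c₂ =>
        [DUP, .len, pushNum 2, SWAP, .less, .if0 [.fail .conv] [],
          DUP, pushNum 1, .idx, SWAP, pushNum 0, .idx, DUP,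
          .if0 (SWAP :: c₁.toHL)
            [DUP, pushNum (-1), .add, .if0 (SWAP :: c₂.toHL) [.fail .conv]]] ++ packArr 2
    | _, _, .prod c₁ c₂ =>
        [DUP, .len, pushNum 2, SWAP, .less, .if0 [.fail .conv] [],
          DUP, pushNum 0, .idx] ++ c₁.toHL ++ [SWAP, pushNum 1, .idx] ++ c₂.toHL ++ packArr 2
end

mutual
  /-- The compiler `e⁺` for RefHL.  The code of a boundary term depends on the types on both sides,
  so compilation proceeds by recursion on the typing derivation. -/
  def HTyping.compile : {ΓL : Env LTy} → {ΓH : Env HTy} → {e : HExp} → {τ : HTy} →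
      HTyping ΓL ΓH e τ → Prog
    | _, _, _, _, .unit => [pushNum 0]
    | _, _, _, _, .true => [pushNum 0]
    | _, _, _, _, .false => [pushNum 1]
    | _, _, _, _, .var (x := x) _ => [.push (.var (.hl x))]
    | _, _, _, _, .inl d =>
        d.compile ++ [.lam (.tmp 0) [.push (.arr [.num 0, .var (.tmp 0)])]]
    | _, _, _, _, .inr d =>
        d.compile ++ [.lam (.tmp 0) [.push (.arr [.num 1, .var (.tmp 0)])]]
    | _, _, _, _, .pair d₁ d₂ => d₁.compile ++ d₂.compile ++ packArr 2
    | _, _, _, _, .fst d => d.compile ++ [pushNum 0, .idx]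
    | _, _, _, _, .snd d => d.compile ++ [pushNum 1, .idx]
    | _, _, _, _, .ite d d₁ d₂ => d.compile ++ [.if0 d₁.compile d₂.compile]
    | _, _, _, _, .lam (x := x) d => [.push (.thunk [.lam (.hl x) d.compile])]
    | _, _, _, _, .app d₁ d₂ => d₁.compile ++ d₂.compile ++ [SWAP, .call]
    | _, _, _, _, .case (x := x) (y := y) d d₁ d₂ =>
        d.compile ++ [DUP, pushNum 1, .idx, SWAP, pushNum 0, .idx,
          .if0 [.lam (.hl x) d₁.compile] [.lam (.hl y) d₂.compile]]
    | _, _, _, _, .ref d => d.compile ++ [.alloc]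
    | _, _, _, _, .deref d => d.compile ++ [.read]
    | _, _, _, _, .assign d₁ d₂ => d₁.compile ++ d₂.compile ++ [.write, pushNum 0]
    | _, _, _, _, .boundary d c => d.compile ++ c.toHL
  /-- The compiler `e⁺` for RefLL. -/
  def LTyping.compile : {ΓH : Env HTy} → {ΓL : Env LTy} → {e : LExp} → {τ : LTy} →
      LTyping ΓH ΓL e τ → Prog
    | _, _, _, _, .num (n := n) => [pushNum n]
    | _, _, _, _, .var (x := x) _ => [.push (.var (.ll x))]
    | _, _, _, _, .arr (es := es) ds => ds.compile ++ packArr es.length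
    | _, _, _, _, .index d₁ d₂ => d₁.compile ++ d₂.compile ++ [.idx]
    | _, _, _, _, .lam (x := x) d => [.push (.thunk [.lam (.ll x) d.compile])]
    | _, _, _, _, .app d₁ d₂ => d₁.compile ++ d₂.compile ++ [SWAP, .call]
    | _, _, _, _, .add d₁ d₂ => d₁.compile ++ d₂.compile ++ [SWAP, .add]
    | _, _, _, _, .if0 d d₁ d₂ => d.compile ++ [.if0 d₁.compile d₂.compile]
    | _, _, _, _, .ref d => d.compile ++ [.alloc]
    | _, _, _, _, .deref d => d.compile ++ [.read]
    | _, _, _, _, .assign d₁ d₂ => d₁.compile ++ d₂.compile ++ [.write, pushNum 0]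
    | _, _, _, _, .boundary d c => d.compile ++ c.toLL
  /-- The compiled elements `e₁⁺, …, eₙ⁺` of an array expression, in sequence. -/
  def LTypings.compile : {ΓH : Env HTy} → {ΓL : Env LTy} → {es : List LExp} → {τ : LTy} →
      LTypings ΓH ΓL es τ → Prog
    | _, _, _, _, .nil => []
    | _, _, _, _, .cons d ds => d.compile ++ ds.compile
end

/-! ## Worlds and type interpretations

The sets `Typ_n` of type interpretations and the worlds are defined by recursion on the step index.
An element of `PreTyp n` is an arbitrary set of pairs `((k, Ψ), v)` with `k < n`, where `Ψ` is a
finite map from locations to `PreTyp k`; it is stored as the sequence of its slices at the indices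
`k = 0, …, n - 1` (see `PreTyp.approx_atoms` and `PreTyp.atoms_approx` below).  `PreTyp.IsTyp` then
selects the elements of `Typ_n`. -/

/-- Arbitrary sets of pairs of a pre-world of index `< n` and a value. -/
def PreTyp : ℕ → Type
  | 0 => Unit
  | n + 1 => PreTyp n × Set (Finmap (fun _ : Loc => PreTyp n) × Val)

/-- Pairs `(k, Ψ)` of a step index and a heap typing, before imposing validity. -/
structure PreWorld where
  k : ℕ
  Ψ : Finmap (fun _ : Loc => PreTyp k)

/-- The set of pairs represented by an element of `PreTyp n`. -/
def PreTyp.atoms : {n : ℕ} → PreTyp n → Set (PreWorld × Val)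
  | 0, _ => ∅
  | n + 1, R => PreTyp.atoms (n := n) R.1 ∪ {a | ∃ Ψ v, (Ψ, v) ∈ R.2 ∧ a = (⟨n, Ψ⟩, v)}

/-- The restriction of a set of pairs to the worlds of index `< j`. -/
def PreTyp.approx : (j : ℕ) → Set (PreWorld × Val) → PreTyp j
  | 0, _ => ()
  | j + 1, R => (PreTyp.approx j R, {a | (⟨j, a.1⟩, a.2) ∈ R})

theorem PreTyp.atoms_lt {n : ℕ} (R : PreTyp n) (a : PreWorld × Val) (h : a ∈ R.atoms) :
    a.1.k < n := by
  induction n with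
  | zero => exact absurd h (by simp [PreTyp.atoms])
  | succ n ih =>
    rcases h with h | ⟨Ψ, v, -, rfl⟩
    · exact Nat.lt_succ_of_lt (ih R.1 h)
    · exact Nat.lt_succ_self n

theorem PreTyp.atoms_approx (j : ℕ) (R : Set (PreWorld × Val)) :
    (PreTyp.approx j R).atoms = {a | a ∈ R ∧ a.1.k < j} := by
  induction j with
  | zero => ext a; simp [PreTyp.atoms]
  | succ j ih =>
    ext ⟨⟨k, Ψ⟩, v⟩
    simp only [PreTyp.atoms, PreTyp.approx, ih, Set.mem_union, Set.mem_ofPred_eq]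
    constructor
    · rintro (⟨h, hk⟩ | ⟨Ψ', v', h, heq⟩)
      · exact ⟨h, Nat.lt_succ_of_lt hk⟩
      · cases heq
        exact ⟨h, Nat.lt_succ_self j⟩
    · rintro ⟨h, hk⟩
      rcases Nat.lt_succ_iff_lt_or_eq.mp hk with hk | hk
      · exact Or.inl ⟨h, hk⟩
      · subst hk
        exact Or.inr ⟨Ψ, v, h, rfl⟩

theorem PreTyp.approx_atoms {n : ℕ} (R : PreTyp n) : PreTyp.approx n R.atoms = R := by
  have key : ∀ (m : ℕ) (X Y : Set (PreWorld × Val)),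
      (∀ a : PreWorld × Val, a.1.k < m → (a ∈ X ↔ a ∈ Y)) →
      PreTyp.approx m X = PreTyp.approx m Y := by
    intro m
    induction m with
    | zero => intros; rfl
    | succ m ih =>
      intro X Y h
      refine Prod.ext (ih X Y fun a ha => h a (Nat.lt_succ_of_lt ha)) ?_
      ext ⟨Ψ, v⟩
      exact h (⟨m, Ψ⟩, v) (Nat.lt_succ_self m)
  induction n with
  | zero => rfl
  | succ j ih =>
    refine Prod.ext ?_ ?_
    · refine Eq.trans (key j _ (PreTyp.atoms (n := j) R.1) ?_) (ih R.1)
      intro a ha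
      constructor
      · rintro (h | ⟨Ψ, v, -, rfl⟩)
        · exact h
        · exact absurd ha (Nat.lt_irrefl j)
      · exact fun h => Or.inl h
    · ext ⟨Ψ, v⟩
      constructor
      · rintro (h | ⟨Ψ', v', h, heq⟩)
        · exact absurd (PreTyp.atoms_lt (n := j) R.1 _ h) (Nat.lt_irrefl j)
        · cases heq
          exact h
      · exact fun h => Or.inr ⟨Ψ, v, h, rfl⟩

/-- World extension `W ⊑ W'`: the index may decrease to some `j`, and all locations of `W` keep
their interpretation, up to `j`-approximation. -/
def PreWorld.Ext (W W' : PreWorld) : Prop :=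
  W'.k ≤ W.k ∧
    ∀ l R, W.Ψ.lookup l = some R → W'.Ψ.lookup l = some (PreTyp.approx W'.k R.atoms)

/-- `R ∈ Typ_n`: `R` is a set of pairs `(W, v)` of a world of index `< n` all of whose heap typing
entries lie in `Typ_{W.k}`, and a closed value, and `R` is closed under world extension.  (The
inequality `W.k < n` holds automatically, see `PreTyp.atoms_lt`.) -/
def PreTyp.IsTyp (n : ℕ) (R : PreTyp n) : Prop :=
  ∀ (W : PreWorld) (v : Val) (_ : W.k < n), (W, v) ∈ R.atoms →
    (∀ l T, W.Ψ.lookup l = some T → PreTyp.IsTyp W.k T) ∧ v.Closed ∧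
    ∀ (W' : PreWorld) (_ : W'.k ≤ W.k),
      (∀ l T, W'.Ψ.lookup l = some T → PreTyp.IsTyp W'.k T) → W.Ext W' → (W', v) ∈ R.atoms
  termination_by n
  decreasing_by all_goals omega

/-- Worlds `(k, Ψ)`: `Ψ` maps finitely many locations to elements of `Typ_k`. -/
structure World extends PreWorld where
  valid : ∀ l T, Ψ.lookup l = some T → PreTyp.IsTyp k T

/-- `W ⊑ W'`. -/
def World.Ext (W W' : World) : Prop := W.toPreWorld.Ext W'.toPreWorld

/-- `W ⊏ W'`: extension with a strictly smaller step index. -/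
def World.SExt (W W' : World) : Prop := W'.k < W.k ∧ W.Ext W'

/-- The `j`-approximation of a set of pairs of a world and a value. -/
def floor (j : ℕ) (R : Set (World × Val)) : PreTyp j :=
  PreTyp.approx j {a | ∃ W : World, W.toPreWorld = a.1 ∧ (W, a.2) ∈ R}

/-- `H : W`: every location in the heap typing of `W` is allocated in `H`, and the value stored
there has the prescribed interpretation in every strictly later world (equivalently, in the world
obtained from `W` by decrementing the index, if it is positive). -/
def HeapSat (H : Heap) (W : World) : Prop :=
  ∀ l R, W.Ψ.lookup l = some R →
    ∃ v, H.lookup l = some v ∧ ∀ W', W.SExt W' → (W'.toPreWorld, v) ∈ R.atoms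

/-! ## The logical relation -/

/-- The expression relation over a value relation `R`: started in a heap satisfying `W`, on any
non-`Fail` stack, a run of `j < W.k` steps to the empty program ends either in a `Conv` or `Idx`
error, or with one new value on the stack, related at a future world in which the `j` steps have
been subtracted from the step budget. -/
def ERel (R : Set (World × Val)) : Set (World × Prog) :=
  {a | ∀ (H : Heap) (S : List Val) (H' : Heap) (S' : Stack) (j : ℕ),
    HeapSat H a.1 → j < a.1.k → Steps j ⟨H, .vals S, a.2⟩ ⟨H', S', []⟩ →
      (S' = .fail .conv ∨ S' = .fail .idx) ∨
      ∃ (v : Val) (W' : World), a.1.Ext W' ∧ W'.k = a.1.k - j ∧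
        S' = .vals (v :: S) ∧ HeapSat H' W' ∧ (W', v) ∈ R}

/-- Function values `thunk lam x.P`, for given argument and result interpretations. -/
def FnRel (R₁ R₂ : Set (World × Val)) : Set (World × Val) :=
  {a | ∃ x P, a.2 = .thunk [.lam x P] ∧ a.2.Closed ∧
    ∀ v W', a.1.SExt W' → (W', v) ∈ R₁ → (W', progSubst1 x v P) ∈ ERel R₂}

/-- Locations that the heap typing maps to the approximation of the given interpretation. -/
def RefRel (R : Set (World × Val)) : Set (World × Val) :=
  {a | ∃ l, a.2 = .loc l ∧ a.1.Ψ.lookup l = some (floor a.1.k R)}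

/-- The value relation `V⟦τ⟧` for RefHL types. -/
def HVal : HTy → Set (World × Val)
  | .unit => {a | a.2 = .num 0}
  | .bool => {a | ∃ n, a.2 = .num n}
  | .sum τ₁ τ₂ =>
      {a | ∃ v, a.2 = .arr [.num 0, v] ∧ (a.1, v) ∈ HVal τ₁} ∪
      {a | ∃ v, a.2 = .arr [.num 1, v] ∧ (a.1, v) ∈ HVal τ₂}
  | .prod τ₁ τ₂ =>
      {a | ∃ v₁ v₂, a.2 = .arr [v₁, v₂] ∧ (a.1, v₁) ∈ HVal τ₁ ∧ (a.1, v₂) ∈ HVal τ₂}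
  | .fn τ₁ τ₂ => FnRel (HVal τ₁) (HVal τ₂)
  | .ref τ => RefRel (HVal τ)

/-- The value relation `V⟦τ⟧` for RefLL types. -/
def LVal : LTy → Set (World × Val)
  | .int => {a | ∃ n, a.2 = .num n}
  | .arr τ => {a | ∃ vs, a.2 = .arr vs ∧ ∀ v ∈ vs, (a.1, v) ∈ LVal τ}
  | .fn τ₁ τ₂ => FnRel (LVal τ₁) (LVal τ₂)
  | .ref τ => RefRel (LVal τ)

/-- `(W, γ) ∈ G⟦Γ⟧`: `γ` has the same domain as `Γ`, and maps each `x : τ` in `Γ` to a value `v`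
with `(W, v) ∈ V⟦τ⟧`. -/
def GRel {Ty : Type} (V : Ty → Set (World × Val)) (Γ : Env Ty) :
    Set (World × (ℕ → Option Val)) :=
  {a | ∀ x, Option.Rel (fun τ v => (a.1, v) ∈ V τ) (Γ.lookup x) (a.2 x)}

/-- Closing a program with a substitution for RefHL variables. -/
def closeH (γ : ℕ → Option Val) (P : Prog) : Prog :=
  progSubst (fun | .hl x => γ x | .ll _ => none | .tmp _ => none) P

/-- Closing a program with a substitution for RefLL variables. -/
def closeL (γ : ℕ → Option Val) (P : Prog) : Prog :=
  progSubst (fun | .hl _ => none | .ll x => γ x | .tmp _ => none) P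

/-- Semantic typing `⟦Γ_H; Γ_L ⊢ e : τ⟧` of a RefLL expression `e` with compilation `P = e⁺`. -/
def LSem (ΓH : Env HTy) (ΓL : Env LTy) (P : Prog) (τ : LTy) : Prop :=
  ∀ (W : World) (γH γL : ℕ → Option Val), (W, γH) ∈ GRel HVal ΓH → (W, γL) ∈ GRel LVal ΓL →
    (W, closeH γH (closeL γL P)) ∈ ERel (LVal τ)

/-- Semantic typing `⟦Γ_L; Γ_H ⊢ e : τ⟧` of a RefHL expression `e` with compilation `P = e⁺`. -/
def HSem (ΓL : Env LTy) (ΓH : Env HTy) (P : Prog) (τ : HTy) : Prop :=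
  ∀ (W : World) (γL γH : ℕ → Option Val), (W, γL) ∈ GRel LVal ΓL → (W, γH) ∈ GRel HVal ΓH →
    (W, closeL γL (closeH γH P)) ∈ ERel (HVal τ)

end RefInterop

namespace RefInterop

/-! ## Worlds and interpretations -/

-- The proof is a step-indexed logical relation argument: every typing rule is matched by a semantic
-- rule about the code that it compiles to, and the theorem follows by induction on derivations.
-- Three facts carry it.
--
-- Value interpretations are closed under world extension (`isInterp_hVal`, `isInterp_lVal`). Hence
-- a value computed early stays good while later code runs and changes the heap, and the
-- interpretation of a type may be stored in a heap typing (`IsInterp.isTyp_floor`).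
--
-- The expression relation is a Hoare triple with a step budget. `Safe` makes this explicit by
-- allowing any starting stack and any postcondition. `Steps.append_inv` cuts a terminating run of
-- `P ++ Q` at the end of `P`, which gives the sequencing rule `Safe.bind`; each machine step lowers
-- the index of the world by one (`Safe.step`). Heap satisfaction constrains stored values only in
-- strictly later worlds, and this is enough because reading them costs a step.
--
-- Conversion code turns values of one type into values of the other (`Conv.acts_toLL`,
-- `Conv.acts_toHL`), by induction on convertibility. References are shared without any code because
-- `bool` and `int` have the same interpretation, not merely interconvertible ones
-- (`hVal_ref_bool`). Both languages are interpreted over the same target values, so a boundary is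
-- just compiled code followed by conversion code.
--
-- For the induction, the two closing substitutions are merged into one substitution related to one
-- semantic environment (`SemTyped`, `semEnv`); at the end `closeH_closeL` and `closeL_closeH` undo
-- the merging.

theorem PreTyp.approx_congr {m : ℕ} {X Y : Set (PreWorld × Val)}
    (h : ∀ a : PreWorld × Val, a.1.k < m → (a ∈ X ↔ a ∈ Y)) :
    PreTyp.approx m X = PreTyp.approx m Y := by
  induction m with
  | zero => rfl
  | succ m ih =>
    refine Prod.ext (ih fun a ha => h a (Nat.lt_succ_of_lt ha)) ?_
    ext ⟨Ψ, v⟩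
    exact h (⟨m, Ψ⟩, v) (Nat.lt_succ_self m)

theorem PreTyp.approx_approx {j k : ℕ} (h : j ≤ k) (X : Set (PreWorld × Val)) :
    PreTyp.approx j (PreTyp.approx k X).atoms = PreTyp.approx j X := by
  refine PreTyp.approx_congr fun a ha => ?_
  rw [PreTyp.atoms_approx]
  exact ⟨fun h' => h'.1, fun h' => ⟨h', ha.trans_le h⟩⟩

/-- All entries of the heap typing are valid. -/
def PreWorld.Valid (W : PreWorld) : Prop :=
  ∀ l T, W.Ψ.lookup l = some T → PreTyp.IsTyp W.k T

/-- The index bounds in the definition only serve its well-founded recursion: the first follows from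
`PreTyp.atoms_lt`, the second is part of `PreWorld.Ext`. -/
theorem PreTyp.isTyp_iff {n : ℕ} {R : PreTyp n} :
    PreTyp.IsTyp n R ↔ ∀ W v, (W, v) ∈ R.atoms → W.Valid ∧ v.Closed ∧
      ∀ W' : PreWorld, W'.Valid → W.Ext W' → (W', v) ∈ R.atoms := by
  rw [PreTyp.IsTyp]
  constructor
  · intro h W v hm
    obtain ⟨h1, h2, h3⟩ := h W v (PreTyp.atoms_lt R _ hm) hm
    exact ⟨h1, h2, fun W' hv he => h3 W' he.1 hv he⟩
  · intro h W v _ hm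
    obtain ⟨h1, h2, h3⟩ := h W v hm
    exact ⟨h1, h2, fun W' _ hv he => h3 W' hv he⟩

theorem PreTyp.IsTyp.approx {n : ℕ} {R : PreTyp n} (h : PreTyp.IsTyp n R) (j : ℕ) :
    PreTyp.IsTyp j (PreTyp.approx j R.atoms) := by
  rw [PreTyp.isTyp_iff] at h ⊢
  intro W v hm
  rw [PreTyp.atoms_approx] at hm ⊢
  obtain ⟨h1, h2, h3⟩ := h W v hm.1
  exact ⟨h1, h2, fun W' hv he => ⟨h3 W' hv he, he.1.trans_lt hm.2⟩⟩

theorem World.Ext.refl (W : World) : W.Ext W :=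
  ⟨le_rfl, fun l R h => by rw [PreTyp.approx_atoms]; exact h⟩

theorem World.Ext.trans {W₁ W₂ W₃ : World} (h : W₁.Ext W₂) (h' : W₂.Ext W₃) : W₁.Ext W₃ :=
  ⟨h'.1.trans h.1, fun l R hl => by
    rw [h'.2 l _ (h.2 l R hl), PreTyp.approx_approx h'.1]⟩

theorem World.SExt.trans_ext {W₁ W₂ W₃ : World} (h : W₁.SExt W₂) (h' : W₂.Ext W₃) :
    W₁.SExt W₃ :=
  ⟨h'.1.trans_lt h.1, h.2.trans h'⟩

theorem World.Ext.trans_sExt {W₁ W₂ W₃ : World} (h : W₁.Ext W₂) (h' : W₂.SExt W₃) :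
    W₁.SExt W₃ :=
  ⟨h'.1.trans_le h.1, h.trans h'.2⟩

/-- Lowering the index of a world changes the type `PreTyp k` of its entries, so a map between
finite maps with different codomains is needed. -/
theorem exists_finmap_map {β γ : Type} (f : β → γ) (m : Finmap (fun _ : Loc => β)) :
    ∃ m' : Finmap (fun _ : Loc => γ), ∀ l, m'.lookup l = (m.lookup l).map f := by
  induction m using Finmap.induction_on with
  | _ s =>
    induction s using AList.insertRec with
    | H0 => exact ⟨∅, fun l => by simp⟩
    | IH a b s ha ih =>
      obtain ⟨m', hm⟩ := ih
      refine ⟨m'.insert a (f b), fun l => ?_⟩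
      rw [← Finmap.insert_toFinmap]
      by_cases hl : l = a
      · subst hl; simp
      · rw [Finmap.lookup_insert_of_ne _ hl, Finmap.lookup_insert_of_ne _ hl, hm]

/-- Restricting the heap typing of a world to a smaller index. -/
theorem World.exists_lower (W : World) {j : ℕ} (hj : j ≤ W.k) :
    ∃ W' : World, W.Ext W' ∧ W'.k = j ∧
      ∀ l, W'.Ψ.lookup l = none ↔ W.Ψ.lookup l = none := by
  obtain ⟨m, hm⟩ := exists_finmap_map (fun R : PreTyp W.k => PreTyp.approx j R.atoms) W.Ψ
  refine ⟨⟨⟨j, m⟩, fun l T h => ?_⟩, ⟨hj, fun l R h => ?_⟩, rfl, fun l => ?_⟩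
  · simp only [hm, Option.map_eq_some_iff] at h
    obtain ⟨R, hR, rfl⟩ := h
    exact (W.valid l R hR).approx j
  · simp [hm, h]
  · simp [hm]

theorem lookup_insert_eq_ite {β : Type} (m : Finmap (fun _ : Loc => β)) (l l' : Loc)
    (b : β) : (m.insert l b).lookup l' = if l' = l then some b else m.lookup l' := by
  by_cases h : l' = l
  · subst h; simp
  · rw [Finmap.lookup_insert_of_ne _ h, if_neg h]

/-- Extending the heap typing of a world by an interpretation of a location. -/
def World.insert (W : World) (l : Loc) (R : PreTyp W.k) (hR : PreTyp.IsTyp W.k R) : World where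
  k := W.k
  Ψ := W.Ψ.insert l R
  valid := fun l' T h => by
    simp only [lookup_insert_eq_ite] at h
    split_ifs at h
    · cases h; exact hR
    · exact W.valid l' T h

theorem World.ext_insert (W : World) {l : Loc} (hl : W.Ψ.lookup l = none) (R : PreTyp W.k)
    (hR : PreTyp.IsTyp W.k R) : W.Ext (W.insert l R hR) := by
  refine ⟨le_rfl, fun l' R' h => ?_⟩
  have : l' ≠ l := by rintro rfl; simp [hl] at h
  change (W.Ψ.insert l R).lookup l' = some (PreTyp.approx W.k _)
  rw [lookup_insert_eq_ite, if_neg this, h, PreTyp.approx_atoms]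

/-- Sets of pairs of a world and a closed value that are closed under world extension. -/
structure IsInterp (R : Set (World × Val)) : Prop where
  closed : ∀ {W v}, (W, v) ∈ R → v.Closed
  mono : ∀ {W W' v}, W.Ext W' → (W, v) ∈ R → (W', v) ∈ R

/-- Validity is a proposition, so a world is determined by its underlying pre-world and passing
through pre-worlds loses nothing. -/
theorem mem_floor_atoms {j : ℕ} {R : Set (World × Val)} {W : World} {v : Val} :
    (W.toPreWorld, v) ∈ (floor j R).atoms ↔ (W, v) ∈ R ∧ W.k < j := by
  rw [floor, PreTyp.atoms_approx]
  constructor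
  · rintro ⟨⟨⟨W', h'⟩, hW, hR⟩, hk⟩
    obtain rfl : W' = W.toPreWorld := hW
    exact ⟨hR, hk⟩
  · rintro ⟨h, hk⟩
    exact ⟨⟨W, rfl, h⟩, hk⟩

theorem approx_floor {j k : ℕ} (h : j ≤ k) (R : Set (World × Val)) :
    PreTyp.approx j (floor k R).atoms = floor j R :=
  PreTyp.approx_approx h _

/-- This makes `floor` of a value relation a legal heap typing entry, as allocation requires. -/
theorem IsInterp.isTyp_floor {R : Set (World × Val)} (h : IsInterp R) (j : ℕ) :
    PreTyp.IsTyp j (floor j R) := by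
  rw [PreTyp.isTyp_iff]
  intro W v hm
  have hm' := hm
  rw [floor, PreTyp.atoms_approx] at hm
  obtain ⟨⟨W₀, hW, hR⟩, hk⟩ := hm
  cases hW
  refine ⟨W₀.valid, h.closed hR, fun W' hv he => ?_⟩
  exact (mem_floor_atoms (W := ⟨W', hv⟩)).2
    ⟨h.mono (W' := ⟨W', hv⟩) he hR, he.1.trans_lt hk⟩

/-- Monotonicity is built into the quantification over all strict extensions, so nothing is needed
of the argument and result relations. -/
theorem isInterp_fnRel (R₁ R₂ : Set (World × Val)) : IsInterp (FnRel R₁ R₂) where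
  closed := fun ⟨_, _, _, h, _⟩ => h
  mono := fun he ⟨x, P, h₁, h₂, h₃⟩ => ⟨x, P, h₁, h₂, fun v W' hW => h₃ v W' (he.trans_sExt hW)⟩

theorem isInterp_refRel (R : Set (World × Val)) : IsInterp (RefRel R) where
  closed := by
    rintro W v ⟨l, hl, -⟩
    obtain rfl : v = .loc l := hl
    simp [Val.Closed, Val.fv]
  mono := by
    rintro W W' v he ⟨l, hl, h⟩
    exact ⟨l, hl, by rw [he.2 l _ h]; exact congrArg _ (approx_floor he.1 R)⟩

theorem closed_num (n : ℤ) : (Val.num n).Closed := by simp [Val.Closed, Val.fv]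

theorem closed_arr {vs : List Val} : (Val.arr vs).Closed ↔ ∀ v ∈ vs, v.Closed := by
  simp only [Val.Closed, Val.fv]
  induction vs with
  | nil => simp [valsFv]
  | cons v vs ih => simp [valsFv, ih]

theorem closed_arr_pair {v w : Val} : (Val.arr [v, w]).Closed ↔ v.Closed ∧ w.Closed := by
  simp [closed_arr]

theorem isInterp_hVal (τ : HTy) : IsInterp (HVal τ) := by
  induction τ with
  | unit =>
    refine ⟨?_, fun _ h => h⟩
    rintro W v h
    obtain rfl : v = .num 0 := h
    exact closed_num 0
  | bool =>
    refine ⟨?_, fun _ h => h⟩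
    rintro W v ⟨n, h⟩
    obtain rfl : v = .num n := h
    exact closed_num n
  | sum τ₁ τ₂ ih₁ ih₂ =>
    constructor
    · rintro W v (⟨w, h, hw⟩ | ⟨w, h, hw⟩)
      · obtain rfl : v = .arr [.num 0, w] := h
        exact closed_arr_pair.2 ⟨closed_num 0, ih₁.closed hw⟩
      · obtain rfl : v = .arr [.num 1, w] := h
        exact closed_arr_pair.2 ⟨closed_num 1, ih₂.closed hw⟩
    · rintro W W' v he (⟨w, h, hw⟩ | ⟨w, h, hw⟩)
      · exact Or.inl ⟨w, h, ih₁.mono he hw⟩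
      · exact Or.inr ⟨w, h, ih₂.mono he hw⟩
  | prod τ₁ τ₂ ih₁ ih₂ =>
    constructor
    · rintro W v ⟨v₁, v₂, h, h₁, h₂⟩
      obtain rfl : v = .arr [v₁, v₂] := h
      exact closed_arr_pair.2 ⟨ih₁.closed h₁, ih₂.closed h₂⟩
    · rintro W W' v he ⟨v₁, v₂, h, h₁, h₂⟩
      exact ⟨v₁, v₂, h, ih₁.mono he h₁, ih₂.mono he h₂⟩
  | fn τ₁ τ₂ => exact isInterp_fnRel _ _
  | ref τ => exact isInterp_refRel _

theorem isInterp_lVal (τ : LTy) : IsInterp (LVal τ) := by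
  induction τ with
  -- The interpretations of `int` and `bool` unfold to the same set.
  | int => exact isInterp_hVal .bool
  | arr τ ih =>
    constructor
    · rintro W v ⟨vs, h, hvs⟩
      obtain rfl : v = .arr vs := h
      exact closed_arr.2 fun w hw => ih.closed (hvs w hw)
    · rintro W W' v he ⟨vs, h, hvs⟩
      exact ⟨vs, h, fun w hw => ih.mono he (hvs w hw)⟩
  | fn τ₁ τ₂ => exact isInterp_fnRel _ _
  | ref τ => exact isInterp_refRel _

/-! ## Heap satisfaction -/

/-- Approximation only discards worlds of index at least `W'.k`, and strict extensions of `W'` lie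
below that. Equality of domains is essential: `H` need not provide anything for additional locations
of `W'`. -/
theorem HeapSat.lower {H : Heap} {W W' : World} (h : HeapSat H W) (he : W.Ext W')
    (hd : ∀ l, W'.Ψ.lookup l = none ↔ W.Ψ.lookup l = none) : HeapSat H W' := by
  intro l R' hR'
  cases hR : W.Ψ.lookup l with
  | none => rw [(hd l).2 hR] at hR'; cases hR'
  | some R =>
    obtain ⟨v, hv, hW⟩ := h l R hR
    refine ⟨v, hv, fun W'' hs => ?_⟩
    rw [he.2 l R hR] at hR'
    cases hR'
    rw [PreTyp.atoms_approx]
    exact ⟨hW W'' (he.trans_sExt hs), hs.1⟩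

theorem HeapSat.exists_pred {H : Heap} {W : World} (h : HeapSat H W) (hk : 0 < W.k) :
    ∃ W' : World, W.SExt W' ∧ W'.k + 1 = W.k ∧ HeapSat H W' := by
  obtain ⟨W', he, hk', hd⟩ := W.exists_lower (Nat.sub_le W.k 1)
  exact ⟨W', ⟨by omega, he⟩, by omega, h.lower he hd⟩

/-- A location fresh for the heap is fresh for the heap typing, since every typed location is
allocated; so adding an entry there is a world extension. -/
theorem HeapSat.alloc {H : Heap} {W : World} (h : HeapSat H W) {l : Loc} (hl : l ∉ H)
    {R : Set (World × Val)} (hR : IsInterp R) {v : Val} (hv : (W, v) ∈ R) :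
    ∃ W' : World, W.Ext W' ∧ W'.k = W.k ∧ HeapSat (H.insert l v) W' ∧
      (W', .loc l) ∈ RefRel R := by
  have hl' : W.Ψ.lookup l = none := by
    cases hT : W.Ψ.lookup l with
    | none => rfl
    | some T =>
      obtain ⟨w, hw, -⟩ := h l T hT
      exact absurd (Finmap.mem_of_lookup_eq_some hw) hl
  have he := W.ext_insert hl' (floor W.k R) (hR.isTyp_floor W.k)
  refine ⟨_, he, rfl, fun l' T hT => ?_, l, rfl, Finmap.lookup_insert W.Ψ⟩
  change (W.Ψ.insert l _).lookup l' = some T at hT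
  rw [lookup_insert_eq_ite] at hT
  by_cases hll : l' = l
  · subst hll
    rw [if_pos rfl] at hT
    cases hT
    refine ⟨v, Finmap.lookup_insert _, fun W' hs => ?_⟩
    exact mem_floor_atoms.2 ⟨hR.mono (he.trans hs.2) hv, hs.1⟩
  · rw [if_neg hll] at hT
    obtain ⟨w, hw, hW⟩ := h l' T hT
    exact ⟨w, by rw [Finmap.lookup_insert_of_ne _ hll, hw], fun W' hs => hW W' (he.trans_sExt hs)⟩

/-- The update is type preserving, so the world need not change: the new value lies in `R` at `W`,
hence at all later worlds. -/
theorem HeapSat.write {H : Heap} {W : World} (h : HeapSat H W) {l : Loc}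
    {R : Set (World × Val)} (hR : IsInterp R) (hl : (W, .loc l) ∈ RefRel R) {v : Val}
    (hv : (W, v) ∈ R) : HeapSat (H.insert l v) W := by
  obtain ⟨_, heq, hl⟩ := hl
  cases heq
  intro l' T hT
  by_cases hll : l' = l
  · subst hll
    refine ⟨v, Finmap.lookup_insert _, fun W' hs => ?_⟩
    rw [hl] at hT
    cases hT
    exact mem_floor_atoms.2 ⟨hR.mono hs.2 hv, hs.1⟩
  · obtain ⟨w, hw, hW⟩ := h l' T hT
    exact ⟨w, by rw [Finmap.lookup_insert_of_ne _ hll, hw], hW⟩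

/-- The content is only known to be good in strictly later worlds; the step taken by `read` leads to
one. -/
theorem HeapSat.read {H : Heap} {W : World} (h : HeapSat H W) {l : Loc}
    {R : Set (World × Val)} (hl : (W, .loc l) ∈ RefRel R) :
    ∃ v, H.lookup l = some v ∧ ∀ W', W.SExt W' → (W', v) ∈ R := by
  obtain ⟨_, heq, hl⟩ := hl
  cases heq
  obtain ⟨v, hv, hW⟩ := h l _ hl
  exact ⟨v, hv, fun W₁ hs => (mem_floor_atoms.1 (hW W₁ hs)).1⟩

/-! ## Substitution -/

mutual
  theorem Val.subst_of_fv {σ : TVar → Option Val} :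
      (v : Val) → (∀ y ∈ v.fv, σ y = none) → v.subst σ = v
    | .num _, _ => by simp [Val.subst]
    | .thunk P, h => by
        rw [Val.subst, progSubst_of_fv P (by simpa [Val.fv] using h)]
    | .loc _, _ => by simp [Val.subst]
    | .arr vs, h => by
        rw [Val.subst, valsSubst_of_fv vs (by simpa [Val.fv] using h)]
    | .var x, h => by simp [Val.subst, h x (by simp [Val.fv])]
  theorem Instr.subst_of_fv {σ : TVar → Option Val} :
      (i : Instr) → (∀ y ∈ i.fv, σ y = none) → i.subst σ = i
    | .push v, h => by rw [Instr.subst, Val.subst_of_fv v (by simpa [Instr.fv] using h)]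
    | .if0 P₁ P₂, h => by
        rw [Instr.subst, progSubst_of_fv P₁ fun y hy => h y (by simp [Instr.fv, hy]),
          progSubst_of_fv P₂ fun y hy => h y (by simp [Instr.fv, hy])]
    | .lam x P, h => by
        rw [Instr.subst, progSubst_of_fv P fun y hy => ?_]
        by_cases hx : y = x
        · simp [hx]
        · simp [hx, h y (by simp [Instr.fv, hy, hx])]
    | .add, _ | .less, _ | .call, _ | .idx, _ | .len, _ | .alloc, _ | .read, _ | .write, _
    | .fail _, _ => by simp [Instr.subst]
  theorem progSubst_of_fv {σ : TVar → Option Val} :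
      (P : List Instr) → (∀ y ∈ progFv P, σ y = none) → progSubst σ P = P
    | [], _ => by simp [progSubst]
    | i :: P, h => by
        rw [progSubst, Instr.subst_of_fv i fun y hy => h y (by simp [progFv, hy]),
          progSubst_of_fv P fun y hy => h y (by simp [progFv, hy])]
  theorem valsSubst_of_fv {σ : TVar → Option Val} :
      (vs : List Val) → (∀ y ∈ valsFv vs, σ y = none) → valsSubst σ vs = vs
    | [], _ => by simp [valsSubst]
    | v :: vs, h => by
        rw [valsSubst, Val.subst_of_fv v fun y hy => h y (by simp [valsFv, hy]),
          valsSubst_of_fv vs fun y hy => h y (by simp [valsFv, hy])]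
end

theorem Val.Closed.subst {v : Val} (h : v.Closed) (σ : TVar → Option Val) : v.subst σ = v :=
  Val.subst_of_fv v fun y hy => by rw [h] at hy; cases hy

theorem progSubst_of_closed {P : Prog} (h : progFv P = ∅) (σ : TVar → Option Val) :
    progSubst σ P = P :=
  progSubst_of_fv P fun y hy => by rw [h] at hy; cases hy

/-- The substitution `σ` followed by `σ'`, when `σ` has closed values. -/
def substComp (σ ρ : TVar → Option Val) : TVar → Option Val := fun y => (σ y).or (ρ y)

/-- All values of a substitution are closed. -/
def ClosedSubst (σ : TVar → Option Val) : Prop := ∀ y v, σ y = some v → v.Closed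

/-- The substitution `σ` without its value at `x`. -/
abbrev substErase (σ : TVar → Option Val) (x : TVar) : TVar → Option Val :=
  fun y => if y = x then none else σ y

theorem ClosedSubst.erase {σ : TVar → Option Val} (h : ClosedSubst σ) (x : TVar) :
    ClosedSubst (substErase σ x) := by
  intro y v hy
  by_cases hx : y = x
  · simp [substErase, hx] at hy
  · exact h y v (by simpa [substErase, hx] using hy)

theorem substComp_erase (σ σ' : TVar → Option Val) (x : TVar) :
    substComp (substErase σ x) (substErase σ' x) = substErase (substComp σ σ') x := by
  funext y
  by_cases hx : y = x <;> simp [substComp, substErase, hx]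

-- The values of `σ` are closed, so `σ'` cannot act on them, and where both are defined `σ` wins.
mutual
  theorem Val.subst_subst {σ σ' : TVar → Option Val} (h : ClosedSubst σ) :
      (v : Val) → (v.subst σ).subst σ' = v.subst (substComp σ σ')
    | .num _ => by simp [Val.subst]
    | .thunk P => by simp only [Val.subst]; rw [progSubst_progSubst h P]
    | .loc _ => by simp [Val.subst]
    | .arr vs => by simp only [Val.subst]; rw [valsSubst_valsSubst h vs]
    | .var x => by
        cases hx : σ x with
        | none => simp [Val.subst, substComp, hx]
        | some v => simpa [Val.subst, substComp, hx] using (h x v hx).subst σ'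
  theorem Instr.subst_subst {σ σ' : TVar → Option Val} (h : ClosedSubst σ) :
      (i : Instr) → (i.subst σ).subst σ' = i.subst (substComp σ σ')
    | .push v => by simp only [Instr.subst]; rw [Val.subst_subst h v]
    | .if0 P₁ P₂ => by
        simp only [Instr.subst]
        rw [progSubst_progSubst h P₁, progSubst_progSubst h P₂]
    | .lam x P => by
        simp only [Instr.subst]
        rw [progSubst_progSubst (h.erase x) P, substComp_erase]
    | .add | .less | .call | .idx | .len | .alloc | .read | .write | .fail _ => by
        simp [Instr.subst]
  theorem progSubst_progSubst {σ σ' : TVar → Option Val} (h : ClosedSubst σ) :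
      (P : List Instr) → progSubst σ' (progSubst σ P) = progSubst (substComp σ σ') P
    | [] => by simp [progSubst]
    | i :: P => by simp only [progSubst]; rw [Instr.subst_subst h i, progSubst_progSubst h P]
  theorem valsSubst_valsSubst {σ σ' : TVar → Option Val} (h : ClosedSubst σ) :
      (vs : List Val) → valsSubst σ' (valsSubst σ vs) = valsSubst (substComp σ σ') vs
    | [] => by simp [valsSubst]
    | v :: vs => by simp only [valsSubst]; rw [Val.subst_subst h v, valsSubst_valsSubst h vs]
end

-- Used to see that a compiled function becomes a closed value once its environment has been
-- substituted.
mutual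
  theorem Val.fv_subst {σ : TVar → Option Val} (h : ClosedSubst σ) :
      (v : Val) → ∀ y ∈ (v.subst σ).fv, y ∈ v.fv ∧ σ y = none
    | .num _, y, hy => by simp [Val.subst, Val.fv] at hy
    | .thunk P, y, hy => by
        simp only [Val.subst, Val.fv] at hy ⊢
        exact progFv_progSubst h P y hy
    | .loc _, y, hy => by simp [Val.subst, Val.fv] at hy
    | .arr vs, y, hy => by
        simp only [Val.subst, Val.fv] at hy ⊢
        exact valsFv_valsSubst h vs y hy
    | .var x, y, hy => by
        cases hx : σ x with
        | none =>
          simp only [Val.subst, hx, Option.getD_none, Val.fv, Set.mem_singleton_iff] at hy ⊢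
          exact ⟨hy, hy ▸ hx⟩
        | some v =>
          simp only [Val.subst, hx, Option.getD_some] at hy
          rw [h x v hx] at hy
          cases hy
  theorem Instr.fv_subst {σ : TVar → Option Val} (h : ClosedSubst σ) :
      (i : Instr) → ∀ y ∈ (i.subst σ).fv, y ∈ i.fv ∧ σ y = none
    | .push v, y, hy => by
        simp only [Instr.subst, Instr.fv] at hy ⊢
        exact Val.fv_subst h v y hy
    | .if0 P₁ P₂, y, hy => by
        simp only [Instr.subst, Instr.fv, Set.mem_union] at hy ⊢
        rcases hy with hy | hy
        · exact ⟨Or.inl (progFv_progSubst h P₁ y hy).1, (progFv_progSubst h P₁ y hy).2⟩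
        · exact ⟨Or.inr (progFv_progSubst h P₂ y hy).1, (progFv_progSubst h P₂ y hy).2⟩
    | .lam x P, y, hy => by
        simp only [Instr.subst, Instr.fv, Set.mem_sdiff, Set.mem_singleton_iff] at hy ⊢
        have := progFv_progSubst (h.erase x) P y hy.1
        exact ⟨⟨this.1, hy.2⟩, by simpa [hy.2] using this.2⟩
    | .add, y, hy | .less, y, hy | .call, y, hy | .idx, y, hy | .len, y, hy | .alloc, y, hy
    | .read, y, hy | .write, y, hy | .fail _, y, hy => by simp [Instr.subst, Instr.fv] at hy
  theorem progFv_progSubst {σ : TVar → Option Val} (h : ClosedSubst σ) :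
      (P : List Instr) → ∀ y ∈ progFv (progSubst σ P), y ∈ progFv P ∧ σ y = none
    | [], y, hy => by simp [progSubst, progFv] at hy
    | i :: P, y, hy => by
        simp only [progSubst, progFv, Set.mem_union] at hy ⊢
        rcases hy with hy | hy
        · exact ⟨Or.inl (Instr.fv_subst h i y hy).1, (Instr.fv_subst h i y hy).2⟩
        · exact ⟨Or.inr (progFv_progSubst h P y hy).1, (progFv_progSubst h P y hy).2⟩
  theorem valsFv_valsSubst {σ : TVar → Option Val} (h : ClosedSubst σ) :
      (vs : List Val) → ∀ y ∈ valsFv (valsSubst σ vs), y ∈ valsFv vs ∧ σ y = none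
    | [], y, hy => by simp [valsSubst, valsFv] at hy
    | v :: vs, y, hy => by
        simp only [valsSubst, valsFv, Set.mem_union] at hy ⊢
        rcases hy with hy | hy
        · exact ⟨Or.inl (Val.fv_subst h v y hy).1, (Val.fv_subst h v y hy).2⟩
        · exact ⟨Or.inr (valsFv_valsSubst h vs y hy).1, (valsFv_valsSubst h vs y hy).2⟩
end

theorem progSubst_append (σ : TVar → Option Val) (P Q : Prog) :
    progSubst σ (P ++ Q) = progSubst σ P ++ progSubst σ Q := by
  induction P with
  | nil => simp [progSubst]
  | cons i P ih => simp [progSubst, ih]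

theorem progFv_append (P Q : Prog) : progFv (P ++ Q) = progFv P ∪ progFv Q := by
  induction P with
  | nil => simp [progFv]
  | cons i P ih => simp [progFv, ih, Set.union_assoc]

theorem valsSubst_eq_map (σ : TVar → Option Val) (vs : List Val) :
    valsSubst σ vs = vs.map (Val.subst σ) := by
  induction vs with
  | nil => simp [valsSubst]
  | cons v vs ih => simp [valsSubst, ih]

theorem progFv_lamTmps (n : ℕ) (P : Prog) :
    progFv (lamTmps n P) = progFv P \ {y | ∃ i < n, y = .tmp i} := by
  induction n with
  | zero => simp [lamTmps]
  | succ n ih =>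
    ext y
    simp only [lamTmps, progFv, Instr.fv, ih, Set.union_empty, Set.mem_sdiff, Set.mem_ofPred_eq,
      Set.mem_singleton_iff, Nat.lt_succ_iff_lt_or_eq]
    constructor
    · rintro ⟨⟨h₁, h₂⟩, h₃⟩
      refine ⟨h₁, ?_⟩
      rintro ⟨i, hi | rfl, rfl⟩
      · exact h₂ ⟨i, hi, rfl⟩
      · exact h₃ rfl
    · rintro ⟨h₁, h₂⟩
      exact ⟨⟨h₁, fun ⟨i, hi, h⟩ => h₂ ⟨i, Or.inl hi, h⟩⟩, fun h => h₂ ⟨n, Or.inr rfl, h⟩⟩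

theorem mem_valsFv {y : TVar} {vs : List Val} : y ∈ valsFv vs ↔ ∃ v ∈ vs, y ∈ v.fv := by
  induction vs with
  | nil => simp [valsFv]
  | cons v vs ih => simp [valsFv, ih]

theorem progFv_packArr (n : ℕ) : progFv (packArr n) = ∅ := by
  rw [packArr, progFv_lamTmps, Set.sdiff_eq_empty]
  intro y hy
  simp only [progFv, Instr.fv, Val.fv, Set.union_empty, mem_valsFv, List.mem_map,
    List.mem_range] at hy
  obtain ⟨v, ⟨i, hi, rfl⟩, hy⟩ := hy
  exact ⟨i, hi, by simpa [Val.fv] using hy⟩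

theorem progSubst_lamTmps {σ : TVar → Option Val} {n : ℕ} (h : ∀ i < n, σ (.tmp i) = none)
    (P : Prog) : progSubst σ (lamTmps n P) = lamTmps n (progSubst σ P) := by
  induction n with
  | zero => simp [lamTmps]
  | succ n ih =>
    have : (fun y => if y = TVar.tmp n then none else σ y) = σ := by
      funext y
      split_ifs with hy
      · rw [hy, h n (Nat.lt_succ_self n)]
      · rfl
    simp only [lamTmps, progSubst, Instr.subst, this]
    rw [ih fun i hi => h i (Nat.lt_succ_of_lt hi)]

/-! ## Deterministic reductions that do not depend on the heap -/

/-- In every heap, the only step of the first configuration leads to the second one. -/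
def PureStep (c d : List Val × Prog) : Prop :=
  ∀ H e, Step ⟨H, .vals c.1, c.2⟩ e ↔ e = ⟨H, .vals d.1, d.2⟩

/-- One or more pure steps. -/
abbrev PureRun : List Val × Prog → List Val × Prog → Prop := Relation.TransGen PureStep

/-- Any applicable reduction rule rules out the dynamic type error, so determinism of `Red` at this
configuration suffices. -/
theorem PureStep.of_red {S S' : List Val} {i : Instr} {P P' : Prog}
    (h : ∀ H, Red ⟨H, .vals S, i :: P⟩ ⟨H, .vals S', P'⟩)
    (hd : ∀ H d, Red ⟨H, .vals S, i :: P⟩ d → d = ⟨H, .vals S', P'⟩) :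
    PureStep (S, i :: P) (S', P') := by
  intro H d
  constructor
  · intro hs
    cases hs with
    | red hr => exact hd H d hr
    | type _ _ _ _ hn => exact absurd (h H) (hn _)
  · rintro rfl
    exact .red (h H)

theorem pureStep_push (S : List Val) (v : Val) (P : Prog) :
    PureStep (S, .push v :: P) (v :: S, P) :=
  .of_red (fun _ => .push ..) fun _ _ h => by cases h; rfl

theorem pureStep_add (S : List Val) (n n' : ℤ) (P : Prog) :
    PureStep (.num n :: .num n' :: S, .add :: P) (.num (n + n') :: S, P) :=
  .of_red (fun _ => .add ..) fun _ _ h => by cases h; rfl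

theorem pureStep_less (S : List Val) (n n' : ℤ) (P : Prog) :
    PureStep (.num n :: .num n' :: S, .less :: P) (.num (if n < n' then 0 else 1) :: S, P) :=
  .of_red (fun _ => .less ..) fun _ _ h => by cases h; rfl

theorem pureStep_if0 (S : List Val) (n : ℤ) (P₁ P₂ P : Prog) :
    PureStep (.num n :: S, .if0 P₁ P₂ :: P) (S, (if n = 0 then P₁ else P₂) ++ P) :=
  .of_red (fun _ => .if0 ..) fun _ _ h => by cases h; rfl

theorem pureStep_lam (S : List Val) (v : Val) (x : TVar) (P₁ P : Prog) :
    PureStep (v :: S, .lam x P₁ :: P) (S, progSubst1 x v P₁ ++ P) :=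
  .of_red (fun _ => .lam ..) fun _ _ h => by cases h; rfl

theorem pureStep_call (S : List Val) (P₁ P : Prog) :
    PureStep (.thunk P₁ :: S, .call :: P) (S, P₁ ++ P) :=
  .of_red (fun _ => .call ..) fun _ _ h => by cases h; rfl

theorem pureStep_idx (S vs : List Val) {n : ℕ} {v : Val} (h : vs[n]? = some v) (P : Prog) :
    PureStep (.num (n : ℤ) :: .arr vs :: S, .idx :: P) (v :: S, P) := by
  refine .of_red (fun _ => .idx _ _ _ _ _ _ h) fun H d hr => ?_
  -- Case analysis cannot unify two integer casts of naturals, so the index is first replaced by a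
  -- variable.
  generalize hm : (n : ℤ) = m at hr
  cases hr with
  | idx _ _ _ n' v' _ h' =>
    obtain rfl : n = n' := by exact_mod_cast hm
    rw [h] at h'
    cases h'
    rfl
  | idxFail _ _ _ _ _ hn =>
    have := (List.getElem?_eq_some_iff.1 h).1
    omega

theorem pureStep_idx_fail (S vs : List Val) {n : ℤ} (h : ¬(0 ≤ n ∧ n < (vs.length : ℤ)))
    (P : Prog) : PureStep (.num n :: .arr vs :: S, .idx :: P) (S, [.fail .idx]) := by
  refine .of_red (fun _ => .idxFail _ _ _ _ _ h) fun H d hr => ?_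
  cases hr with
  | idx _ _ _ n' v' _ h' =>
    have := (List.getElem?_eq_some_iff.1 h').1
    omega
  | idxFail => rfl

theorem pureStep_len (S vs : List Val) (P : Prog) :
    PureStep (.arr vs :: S, .len :: P) (.num (vs.length : ℤ) :: S, P) :=
  .of_red (fun _ => .len ..) fun _ _ h => by cases h; rfl

theorem pureRun_push_idx (S vs : List Val) {n : ℕ} {v : Val} (h : vs[n]? = some v) (P : Prog) :
    PureRun (.arr vs :: S, pushNum n :: .idx :: P) (v :: S, P) :=
  .tail (.single (pureStep_push _ _ _)) (pureStep_idx _ _ h _)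

theorem pureRun_dup (S : List Val) (v : Val) (P : Prog) :
    PureRun (v :: S, DUP :: P) (v :: v :: S, P) := by
  refine .head (pureStep_lam S v (.tmp 0) _ P) ?_
  simp only [progSubst1, progSubst, Instr.subst, Val.subst, pushTmp, if_true, Option.getD_some,
    List.cons_append, List.nil_append]
  exact .head (pureStep_push _ _ _) (.single (pureStep_push _ _ _))

/-- Only `v` must be closed: it is placed under the second binder and so undergoes the substitution
for `tmp 1`. -/
theorem pureRun_swap (S : List Val) {v : Val} (hv : v.Closed) (w : Val) (P : Prog) :
    PureRun (v :: w :: S, SWAP :: P) (w :: v :: S, P) := by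
  refine .head (pureStep_lam (w :: S) v (.tmp 0) _ P) ?_
  simp only [progSubst1, progSubst, Instr.subst, Val.subst, pushTmp, if_true,
    List.cons_append, List.nil_append]
  refine .head (pureStep_lam S w (.tmp 1) _ P) ?_
  simp only [progSubst1, progSubst, Instr.subst, Val.subst, if_true, if_false,
    Option.getD_some, Option.getD_none, List.cons_append, List.nil_append, TVar.tmp.injEq,
    zero_ne_one, hv.subst]
  exact .head (pureStep_push _ _ _) (.single (pureStep_push _ _ _))

/-- `SPLIT` extracts the first two components of an array. -/
theorem pureRun_split (S : List Val) {vs : List Val} {v w : Val} (hv : vs[0]? = some v)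
    (hw : vs[1]? = some w) (hc : w.Closed) (P : Prog) :
    PureRun (.arr vs :: S, DUP :: pushNum 1 :: .idx :: SWAP :: pushNum 0 :: .idx :: P)
      (v :: w :: S, P) :=
  (pureRun_dup _ _ _).trans <| (pureRun_push_idx _ _ (n := 1) hw _).trans <|
    (pureRun_swap _ hc _ _).trans <| pureRun_push_idx _ _ (n := 0) hv _

/-- The substitution of the values `vs` for `tmp 0, tmp 1, …`. -/
def tmpSubst (vs : List Val) : TVar → Option Val
  | .tmp i => vs[i]?
  | .hl _ => none
  | .ll _ => none

/-- The outermost binder has the largest index and pops the last value of `vs`, so the induction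
removes values from the end; `P` varies because that substitution moves under the remaining binders.
Without binders no step is taken, hence the reflexive closure. -/
theorem reflTransGen_pureStep_lamTmps (S : List Val) (Q : Prog) {vs : List Val}
    (hvs : ∀ v ∈ vs, v.Closed) (P : Prog) :
    Relation.ReflTransGen PureStep (vs.reverse ++ S, lamTmps vs.length P ++ Q)
      (S, progSubst (tmpSubst vs) P ++ Q) := by
  induction vs using List.reverseRecOn generalizing P with
  | nil =>
    rw [progSubst_of_fv P fun y _ => by cases y <;> simp [tmpSubst]]
    exact .refl
  | append_singleton vs v ih =>
    have hv : v.Closed := hvs v (by simp)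
    rw [List.length_append, List.length_singleton, List.reverse_append]
    refine .head (pureStep_lam (vs.reverse ++ S) v (.tmp vs.length) _ Q) ?_
    have hσ : ClosedSubst fun y => if y = TVar.tmp vs.length then some v else none := by
      intro y w hy
      by_cases hy' : y = .tmp vs.length
      · simp only [hy', if_true, Option.some.injEq] at hy
        exact hy ▸ hv
      · simp [hy'] at hy
    rw [progSubst1, progSubst_lamTmps fun i hi => by simp [hi.ne]]
    convert ih (fun w hw => hvs w (by simp [hw])) _ using 3
    rw [progSubst_progSubst hσ]
    congr 1
    funext y
    cases y with
    | hl x => simp [substComp, tmpSubst]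
    | ll x => simp [substComp, tmpSubst]
    | tmp i =>
      rcases lt_trichotomy i vs.length with h | h | h
      · simp [substComp, tmpSubst, h.ne, List.getElem?_append_left h]
      · simp [substComp, tmpSubst, h]
      · simp [substComp, tmpSubst, h.ne', h.le, h]

/-- The final `push` provides the one step that a `PureRun` needs even for the empty array. -/
theorem pureRun_packArr (S : List Val) {vs : List Val} (hvs : ∀ v ∈ vs, v.Closed) (P : Prog) :
    PureRun (vs.reverse ++ S, packArr vs.length ++ P) (.arr vs :: S, P) := by
  refine .trans_right (reflTransGen_pureStep_lamTmps S P hvs _) (.single ?_)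
  have : valsSubst (tmpSubst vs) ((List.range vs.length).map fun i => .var (.tmp i)) = vs := by
    rw [valsSubst_eq_map, List.map_map]
    refine List.ext_getElem (by simp) fun i h₁ h₂ => ?_
    simp [Val.subst, tmpSubst, h₂]
  simp only [progSubst, Instr.subst, Val.subst, this]
  exact pureStep_push _ _ _

theorem pureRun_packArr_two (S : List Val) {v w : Val} (hv : v.Closed) (hw : w.Closed) (P : Prog) :
    PureRun (w :: v :: S, packArr 2 ++ P) (.arr [v, w] :: S, P) :=
  pureRun_packArr S (vs := [v, w]) (by simp [hv, hw]) P

/-! ## Sequencing of runs -/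

theorem Steps.nil_eq {j : ℕ} {H : Heap} {S : Stack} {c : Config} (h : Steps j ⟨H, S, []⟩ c) :
    j = 0 ∧ c = ⟨H, S, []⟩ := by
  cases h with
  | refl => exact ⟨rfl, rfl⟩
  | head hs _ => cases hs with | red hr => cases hr

theorem Steps.exists_of_cons {j : ℕ} {H H' : Heap} {S S' : Stack} {i : Instr} {P : Prog}
    (h : Steps j ⟨H, S, i :: P⟩ ⟨H', S', []⟩) :
    ∃ j' c, j = j' + 1 ∧ Step ⟨H, S, i :: P⟩ c ∧ Steps j' c ⟨H', S', []⟩ := by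
  cases h with
  | head hs h => exact ⟨_, _, rfl, hs, h⟩

theorem Steps.fail_inv {j : ℕ} {H H' : Heap} {S S' : Stack} {c : Code} {P : Prog}
    (h : Steps j ⟨H, S, .fail c :: P⟩ ⟨H', S', []⟩) : S' = .fail c := by
  obtain ⟨j', d, rfl, hs, h⟩ := h.exists_of_cons
  cases hs with
  | red hr =>
    cases hr
    have := h.nil_eq.2
    simp only [Config.mk.injEq] at this
    exact this.2.1
  | type _ _ _ _ hn => exact absurd (.fail _ _ _ _) (hn _)

/-- No rule inspects the rest `P` of the program: it either puts code in front of it or discards it.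
Hence the same rule applies with any other continuation `Q`. -/
theorem Red.cons_cases {H : Heap} {S : List Val} {i : Instr} {d : Config} {P : Prog}
    (h : Red ⟨H, .vals S, i :: P⟩ d) :
    (∃ H' S' P', d = ⟨H', .vals S', P' ++ P⟩ ∧ ∀ Q, Red ⟨H, .vals S, i :: Q⟩
      ⟨H', .vals S', P' ++ Q⟩) ∨
    (∃ c S', d = ⟨H, .vals S', [.fail c]⟩ ∧ ∀ Q, Red ⟨H, .vals S, i :: Q⟩
      ⟨H, .vals S', [.fail c]⟩) ∨
    (∃ c, d = ⟨H, .fail c, []⟩ ∧ ∀ Q, Red ⟨H, .vals S, i :: Q⟩ ⟨H, .fail c, []⟩) := by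
  cases h with
  | push => exact .inl ⟨_, _, [], rfl, fun Q => .push ..⟩
  | add => exact .inl ⟨_, _, [], rfl, fun Q => .add ..⟩
  | less => exact .inl ⟨_, _, [], rfl, fun Q => .less ..⟩
  | if0 => exact .inl ⟨_, _, _, rfl, fun Q => .if0 ..⟩
  | lam => exact .inl ⟨_, _, _, rfl, fun Q => .lam ..⟩
  | call => exact .inl ⟨_, _, _, rfl, fun Q => .call ..⟩
  | idx _ _ _ _ _ _ h => exact .inl ⟨_, _, [], rfl, fun Q => .idx _ _ _ _ _ _ h⟩
  | idxFail _ _ _ _ _ h => exact .inr (.inl ⟨_, _, rfl, fun Q => .idxFail _ _ _ _ _ h⟩)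
  | len => exact .inl ⟨_, _, [], rfl, fun Q => .len ..⟩
  | alloc _ _ _ _ _ h => exact .inl ⟨_, _, [], rfl, fun Q => .alloc _ _ _ _ _ h⟩
  | read _ _ _ _ _ h => exact .inl ⟨_, _, [], rfl, fun Q => .read _ _ _ _ _ h⟩
  | write _ _ _ _ _ h => exact .inl ⟨_, _, [], rfl, fun Q => .write _ _ _ _ _ h⟩
  | fail => exact .inr (.inr ⟨_, rfl, fun Q => .fail ..⟩)

/-- A terminating run of `P, Q` either runs `P` to completion and continues with `Q`, or fails
within `P`. -/
theorem Steps.append_inv {j : ℕ} {H H' : Heap} {S : List Val} {S' : Stack} {P Q : Prog}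
    (h : Steps j ⟨H, .vals S, P ++ Q⟩ ⟨H', S', []⟩) :
    (∃ j₁ j₂ H₁ S₁, j = j₁ + j₂ ∧ Steps j₁ ⟨H, .vals S, P⟩ ⟨H₁, .vals S₁, []⟩ ∧
      Steps j₂ ⟨H₁, .vals S₁, Q⟩ ⟨H', S', []⟩) ∨
    (∃ c, S' = .fail c ∧ Steps j ⟨H, .vals S, P⟩ ⟨H', S', []⟩) := by
  induction j generalizing H S P with
  | zero =>
    rcases P with _ | ⟨i, P⟩
    · exact .inl ⟨0, 0, H, S, rfl, .refl _, h⟩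
    · cases h
  | succ j ih =>
    rcases P with _ | ⟨i, P⟩
    · exact .inl ⟨0, j + 1, H, S, by omega, .refl _, h⟩
    · obtain ⟨j', d, hj, hs, h⟩ := h.exists_of_cons
      obtain rfl : j = j' := by omega
      -- A failing instruction discards its continuation, so the run of `P ++ Q` is, with the same
      -- number of steps, a run of `P` alone.
      have hfail : ∀ {S₁ c}, d = ⟨H, .vals S₁, [.fail c]⟩ →
          Step ⟨H, .vals S, i :: P⟩ d → ∃ c, S' = .fail c ∧
            Steps (j + 1) ⟨H, .vals S, i :: P⟩ ⟨H', S', []⟩ := by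
        rintro S₁ c rfl hs'
        exact ⟨c, h.fail_inv, .head hs' h⟩
      cases hs with
      | red hr =>
        rcases hr.cons_cases with ⟨H₁, S₁, P₁, rfl, hQ⟩ | ⟨c, S₁, rfl, hQ⟩ | ⟨c, rfl, hQ⟩
        · change Steps j ⟨H₁, .vals S₁, P₁ ++ (P ++ Q)⟩ _ at h
          rw [← List.append_assoc] at h
          rcases ih h with ⟨j₁, j₂, H₂, S₂, rfl, h₁, h₂⟩ | ⟨c, hc, h₁⟩
          · exact .inl ⟨j₁ + 1, j₂, H₂, S₂, by omega, .head (.red (hQ P)) h₁, h₂⟩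
          · exact .inr ⟨c, hc, .head (.red (hQ P)) h₁⟩
        · exact .inr (hfail rfl (.red (hQ P)))
        · have he := h.nil_eq.2
          simp only [Config.mk.injEq] at he
          exact .inr ⟨c, he.2.1, .head (.red (hQ P)) h⟩
      | type _ _ _ _ hn =>
        -- A reduction available before `P` would also be available before `P ++ Q`, so the type
        -- error is raised in both.
        refine .inr (hfail rfl (.type _ _ _ _ fun d hr => ?_))
        rcases hr.cons_cases with ⟨H₁, S₁, P₁, -, hQ⟩ | ⟨c, S₁, -, hQ⟩ | ⟨c, -, hQ⟩ <;>
          exact hn _ (hQ _)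

/-! ## Safety of a program up to a step index -/

/-- Started on the stack `S` in a heap satisfying `W`, the program `P` either raises an allowed
error or ends with a stack and a future world satisfying `Φ`, as long as the steps fit into the
budget of `W`. -/
def Safe (Φ : World → List Val → Prop) (W : World) (S : List Val) (P : Prog) : Prop :=
  ∀ (H H' : Heap) (S' : Stack) (j : ℕ), HeapSat H W → j < W.k →
    Steps j ⟨H, .vals S, P⟩ ⟨H', S', []⟩ →
      (S' = .fail .conv ∨ S' = .fail .idx) ∨
      ∃ (W₁ : World) (S₁ : List Val), W.Ext W₁ ∧ W₁.k = W.k - j ∧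
        S' = .vals S₁ ∧ HeapSat H' W₁ ∧ Φ W₁ S₁

/-- The postcondition that a value of `R` has been pushed on the stack `S`. -/
def Returns (R : Set (World × Val)) (S : List Val) (W : World) (S' : List Val) : Prop :=
  ∃ v, S' = v :: S ∧ (W, v) ∈ R

/-- With a free postcondition, code that consumes stack entries or leaves several values can be
treated in the same way as expressions. -/
theorem mem_eRel_iff {R : Set (World × Val)} {W : World} {P : Prog} :
    (W, P) ∈ ERel R ↔ ∀ S, Safe (Returns R S) W S P := by
  constructor
  · intro h S H H' S' j hH hj hs
    rcases h H S H' S' j hH hj hs with hf | ⟨v, W', he, hk, rfl, hH', hv⟩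
    · exact .inl hf
    · exact .inr ⟨W', _, he, hk, rfl, hH', v, rfl, hv⟩
  · intro h H S H' S' j hH hj hs
    rcases h S H H' S' j hH hj hs with hf | ⟨W', _, he, hk, rfl, hH', v, rfl, hv⟩
    · exact .inl hf
    · exact .inr ⟨v, W', he, hk, rfl, hH', hv⟩

section

variable {Φ Φ' : World → List Val → Prop} {W : World} {S : List Val} {P Q : Prog}

theorem Safe.nil (h : Φ W S) : Safe Φ W S [] := by
  intro H H' S' j hH hj hs
  obtain ⟨rfl, he⟩ := hs.nil_eq
  simp only [Config.mk.injEq, and_true] at he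
  obtain ⟨rfl, rfl⟩ := he
  exact .inr ⟨W, S, .refl W, rfl, rfl, hH, h⟩

/-- The first part spends `j₁` steps and leaves a world of index `W.k - j₁`, so the remaining `j₂`
steps still fit its budget. -/
theorem Safe.bind (h : Safe Φ W S P) (h' : ∀ W' S', W.Ext W' → Φ W' S' → Safe Φ' W' S' Q) :
    Safe Φ' W S (P ++ Q) := by
  intro H H' S' j hH hj hs
  rcases hs.append_inv with ⟨j₁, j₂, H₁, S₁, rfl, h₁, h₂⟩ | ⟨c, rfl, h₁⟩
  · rcases h _ _ _ _ hH (by omega) h₁ with hf | ⟨W₁, S₂, he, hk, hS, hH₁, hΦ⟩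
    · rcases hf with hf | hf <;> cases hf
    · cases hS
      rcases h' W₁ S₁ he hΦ _ _ _ _ hH₁ (by omega) h₂ with hf | ⟨W₂, S₂, he₂, hk₂, hS, hH₂, hΦ₂⟩
      · exact .inl hf
      · exact .inr ⟨W₂, S₂, he.trans he₂, by omega, hS, hH₂, hΦ₂⟩
  -- The run failed inside `P`, so the error is one that `P` is allowed to raise.
  · rcases h _ _ _ _ hH hj h₁ with hf | ⟨_, _, _, _, hS, _⟩
    · exact .inl hf
    · cases hS

/-- The general rule for a step of the machine. -/
theorem Safe.step {i : Instr}
    (h : ∀ H d, HeapSat H W → 0 < W.k → Step ⟨H, .vals S, i :: P⟩ d →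
      ∃ (H' : Heap) (W' : World) (S' : List Val) (P' : Prog), d = ⟨H', .vals S', P'⟩ ∧
        W.Ext W' ∧ W'.k + 1 = W.k ∧ HeapSat H' W' ∧ Safe Φ W' S' P') : Safe Φ W S (i :: P) := by
  intro H H' S' j hH hj hs
  obtain ⟨j, d, rfl, hs₁, hs⟩ := hs.exists_of_cons
  obtain ⟨H₁, W₁, S₁, P₁, rfl, he, hk, hH₁, hsafe⟩ := h H d hH (by omega) hs₁
  rcases hsafe _ _ _ _ hH₁ (by omega) hs with hf | ⟨W₂, S₂, he₂, hk₂, hS, hH₂, hΦ₂⟩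
  · exact .inl hf
  · exact .inr ⟨W₂, S₂, he.trans he₂, by omega, hS, hH₂, hΦ₂⟩

/-- The continuation may assume a strictly later world; applying a function value depends on this.
-/
theorem Safe.of_pureStep {c : List Val × Prog} (hr : PureStep (S, P) c)
    (h : ∀ W', W.SExt W' → Safe Φ W' c.1 c.2) : Safe Φ W S P := by
  -- The empty program cannot step, so it has no pure step in any heap, in particular not in the
  -- empty one.
  rcases P with _ | ⟨i, P⟩
  · have := (hr ∅ _).2 rfl
    cases this with | red hr => cases hr
  · refine .step fun H d hH hk hs => ?_
    obtain ⟨W', he, hk', hH'⟩ := hH.exists_pred hk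
    exact ⟨H, W', _, _, (hr H d).1 hs, he.2, hk', hH', h W' he⟩

theorem Safe.of_pureRun {c c' : List Val × Prog} (hr : PureRun c c')
    (h : ∀ W', W.SExt W' → Safe Φ W' c'.1 c'.2) : Safe Φ W c.1 c.2 := by
  induction hr using Relation.TransGen.head_induction_on generalizing W with
  | single hs => exact .of_pureStep hs h
  | head hs _ ih => exact .of_pureStep hs fun W' he => ih fun W'' he' => h W'' (he.trans_ext he'.2)

theorem Safe.run {S' : List Val} {P' : Prog} (hr : PureRun (S, P) (S', P'))
    (h : ∀ W', W.SExt W' → Safe Φ W' S' P') : Safe Φ W S P :=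
  .of_pureRun hr h

theorem Safe.fail {c : Code} (hc : c = .conv ∨ c = .idx) : Safe Φ W S (.fail c :: P) := by
  intro H H' S' j hH hj hs
  rw [hs.fail_inv]
  rcases hc with rfl | rfl <;> simp

theorem Safe.alloc {R : Set (World × Val)} (hR : IsInterp R) {v : Val} (hv : (W, v) ∈ R)
    (h : ∀ W' l, W.SExt W' → (W', .loc l) ∈ RefRel R → Safe Φ W' (.loc l :: S) P) :
    Safe Φ W (v :: S) (.alloc :: P) := by
  refine .step fun H d hH hk hs => ?_
  cases hs with
  | red hr =>
    cases hr with
    | alloc _ _ _ l _ hl =>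
      obtain ⟨W₁, he, hk', hH'⟩ := hH.exists_pred hk
      obtain ⟨W₂, he₂, hk₂, hH₂, hl₂⟩ := hH'.alloc hl hR (hR.mono he.2 hv)
      exact ⟨_, W₂, _, _, rfl, he.2.trans he₂, by omega, hH₂, h W₂ l (he.trans_ext he₂) hl₂⟩
  | type _ _ _ _ hn =>
    -- Heaps are finite and locations infinite, so a fresh location exists and allocation is never a
    -- type error.
    obtain ⟨l, hl⟩ := Infinite.exists_notMem_finset H.keys
    exact absurd (Red.alloc H S v l P (by rwa [Finmap.mem_keys] at hl)) (hn _)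

theorem Safe.read {R : Set (World × Val)} {l : Loc} (hl : (W, .loc l) ∈ RefRel R)
    (h : ∀ W' v, W.SExt W' → (W', v) ∈ R → Safe Φ W' (v :: S) P) :
    Safe Φ W (.loc l :: S) (.read :: P) := by
  refine .step fun H d hH hk hs => ?_
  obtain ⟨v, hv, hW⟩ := hH.read hl
  obtain ⟨W₁, he, hk', hH'⟩ := hH.exists_pred hk
  cases hs with
  | red hr =>
    cases hr with
    | read _ _ _ v' _ hv' =>
      rw [hv] at hv'
      cases hv'
      exact ⟨_, W₁, _, _, rfl, he.2, hk', hH', h W₁ v he (hW W₁ he)⟩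
  | type _ _ _ _ hn => exact absurd (Red.read H S l v P hv) (hn _)

theorem Safe.write {R : Set (World × Val)} (hR : IsInterp R) {l : Loc} {v : Val}
    (hl : (W, .loc l) ∈ RefRel R) (hv : (W, v) ∈ R)
    (h : ∀ W', W.SExt W' → Safe Φ W' S P) :
    Safe Φ W (v :: .loc l :: S) (.write :: P) := by
  refine .step fun H d hH hk hs => ?_
  obtain ⟨W₁, he, hk', hH'⟩ := hH.exists_pred hk
  cases hs with
  | red hr =>
    cases hr with
    | write =>
      exact ⟨_, W₁, _, _, rfl, he.2, hk',
        hH'.write hR ((isInterp_refRel R).mono he.2 hl) (hR.mono he.2 hv), h W₁ he⟩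
  | type _ _ _ _ hn =>
    -- A typed location is allocated, so writing to it is never a type error.
    obtain ⟨w, hw, -⟩ := hH.read hl
    exact absurd (Red.write H S l v P (Finmap.mem_of_lookup_eq_some hw)) (hn _)

end

/-! ## Soundness of the conversions -/

/-- The code `Q` replaces a value of `R` on top of the stack by a value of `R'`. -/
def Acts (R R' : Set (World × Val)) (Q : Prog) : Prop :=
  ∀ W v S, (W, v) ∈ R → Safe (Returns R' S) W (v :: S) Q

/-- The code `Q` replaces values of `R₁` and `R₂` on top of the stack by a value of `R'`. -/
def Acts₂ (R₁ R₂ R' : Set (World × Val)) (Q : Prog) : Prop :=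
  ∀ W v₁ v₂ S, (W, v₁) ∈ R₁ → (W, v₂) ∈ R₂ → Safe (Returns R' S) W (v₂ :: v₁ :: S) Q

theorem Safe.ret {R : Set (World × Val)} {W : World} {v : Val} (S : List Val) (h : (W, v) ∈ R) :
    Safe (Returns R S) W (v :: S) [] :=
  .nil ⟨v, rfl, h⟩

theorem Acts.nil {R R' : Set (World × Val)} (h : R ⊆ R') : Acts R R' [] :=
  fun _ _ _ hv => .ret _ (h hv)

theorem Acts.safe {Φ : World → List Val → Prop} {R R' : Set (World × Val)} {Q P : Prog} {W : World}
    {v : Val} {S : List Val} (hA : Acts R R' Q) (hv : (W, v) ∈ R)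
    (h : ∀ W' v', W.Ext W' → (W', v') ∈ R' → Safe Φ W' (v' :: S) P) :
    Safe Φ W (v :: S) (Q ++ P) :=
  (hA W v S hv).bind fun W' _ he ⟨v', hS, hv'⟩ => hS ▸ h W' v' he hv'

theorem safe_packArr_two {R : Set (World × Val)} {W : World} {S : List Val} {v w : Val}
    (hv : v.Closed) (hw : w.Closed) (h : ∀ W', W.SExt W' → (W', .arr [v, w]) ∈ R) :
    Safe (Returns R S) W (w :: v :: S) (packArr 2) := by
  rw [← List.append_nil (packArr 2)]
  exact .run (pureRun_packArr_two S hv hw []) fun W₁ he => .ret S (h W₁ he)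

/-- Conversion of the payload of a tagged value. -/
theorem Acts.safe_tagged {R R' R'' : Set (World × Val)} {Q : Prog} {W : World} {S : List Val}
    {t v : Val} (hA : Acts R R' Q) (hR : IsInterp R) (hR' : IsInterp R') (hR'' : IsInterp R'')
    (ht : t.Closed) (hv : (W, v) ∈ R)
    (h : ∀ W' v', W.Ext W' → (W', v') ∈ R' → (W', .arr [t, v']) ∈ R'') :
    Safe (Returns R'' S) W (t :: v :: S) (SWAP :: (Q ++ packArr 2)) := by
  refine .run (pureRun_swap S ht v _) fun W₁ h₁ => ?_
  refine hA.safe (hR.mono h₁.2 hv) fun W₂ w h₂ hw => ?_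
  exact safe_packArr_two ht (hR'.closed hw) fun W₃ h₃ =>
    hR''.mono h₃.2 (h W₂ w (h₁.2.trans h₂) hw)

/-- Componentwise conversion of the first two entries of an array. -/
theorem Acts.safe_pair {R₁ R₂ R₁' R₂' R : Set (World × Val)} {Q₁ Q₂ : Prog} {W : World}
    {S vs : List Val} {v₁ v₂ : Val} (hA₁ : Acts R₁ R₁' Q₁) (hA₂ : Acts R₂ R₂' Q₂)
    (hR₁ : IsInterp R₁) (hR₂ : IsInterp R₂) (hT₁ : IsInterp R₁')
    (hT₂ : IsInterp R₂') (h₁ : vs[0]? = some v₁) (h₂ : vs[1]? = some v₂) (hv₁ : (W, v₁) ∈ R₁)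
    (hv₂ : (W, v₂) ∈ R₂)
    (h : ∀ W' v₁' v₂', (W', v₁') ∈ R₁' → (W', v₂') ∈ R₂' → (W', .arr [v₁', v₂']) ∈ R) :
    Safe (Returns R S) W (.arr vs :: S)
      ([DUP, pushNum 0, .idx] ++ Q₁ ++ [SWAP, pushNum 1, .idx] ++ Q₂ ++ packArr 2) := by
  simp only [List.append_assoc]
  refine .run ((pureRun_dup S (.arr vs) _).trans (pureRun_push_idx _ _ (n := 0) h₁ _))
    fun W₁ e₁ => ?_
  refine hA₁.safe (hR₁.mono e₁.2 hv₁) fun W₂ v₁' e₂ hw₁ => ?_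
  refine .run ((pureRun_swap S (hT₁.closed hw₁) (.arr vs) _).trans
    (pureRun_push_idx _ _ (n := 1) h₂ _)) fun W₃ e₃ => ?_
  refine hA₂.safe (hR₂.mono (e₁.2.trans (e₂.trans e₃.2)) hv₂) fun W₄ v₂' e₄ hw₂ => ?_
  exact safe_packArr_two (hT₁.closed hw₁) (hT₂.closed hw₂) fun W₅ e₅ =>
    h W₅ _ _ (hT₁.mono (e₃.2.trans (e₄.trans e₅.2)) hw₁) (hT₂.mono e₅.2 hw₂)

/-- `CHECK` fails on arrays with less than two elements. -/
theorem pureRun_check (S vs : List Val) (P : Prog) :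
    PureRun (.arr vs :: S,
        DUP :: .len :: pushNum 2 :: SWAP :: .less :: .if0 [.fail .conv] [] :: P)
      (.arr vs :: S, (if vs.length < 2 then [.fail .conv] else []) ++ P) := by
  refine (pureRun_dup _ _ _).trans <| .head (pureStep_len _ _ _) <| .head (pureStep_push _ _ _) <|
    (pureRun_swap _ (closed_num 2) _ _).trans <| .head (pureStep_less _ _ _ _) ?_
  convert Relation.TransGen.single (pureStep_if0 _ _ _ _ _) using 3
  by_cases h : vs.length < 2
  · have : (vs.length : ℤ) < 2 := by exact_mod_cast h
    simp [h, this]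
  · have : ¬(vs.length : ℤ) < 2 := by exact_mod_cast h
    simp [h, this]

/-- An aliased cell is read and written by both languages, so its content types must have equal
interpretations; both are the set of all integers. -/
theorem hVal_ref_bool : HVal (.ref .bool) = LVal (.ref .int) := by
  simp only [HVal, LVal]

theorem Conv.acts_toLL {τ : HTy} {τ' : LTy} (c : Conv τ τ') : Acts (HVal τ) (LVal τ') c.toLL := by
  induction c with
  | bool => exact .nil fun _ h => h
  | refBool => exact .nil hVal_ref_bool.subset
  | @sum τ₁ τ₂ c₁ c₂ ih₁ ih₂ =>
    rintro W v S (⟨w, h, hw⟩ | ⟨w, h, hw⟩)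
    · obtain rfl : v = .arr [.num 0, w] := h
      refine .run ((pureRun_split S (v := .num 0) rfl rfl ((isInterp_hVal _).closed hw) _).trans
        ((pureRun_dup _ _ _).tail (pureStep_if0 _ _ _ _ _))) fun W₁ e₁ => ?_
      refine ih₁.safe_tagged (isInterp_hVal _) (isInterp_lVal _) (isInterp_lVal _) (closed_num 0)
        ((isInterp_hVal _).mono e₁.2 hw) fun W₂ v' _ hv' => ⟨_, rfl, ?_⟩
      -- Both entries are of type `int`: the tag, being an integer, and the converted payload.
      simpa using ⟨⟨0, rfl⟩, hv'⟩
    · obtain rfl : v = .arr [.num 1, w] := h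
      refine .run ((pureRun_split S (v := .num 1) rfl rfl ((isInterp_hVal _).closed hw) _).trans
        ((pureRun_dup _ _ _).tail (pureStep_if0 _ _ _ _ _))) fun W₁ e₁ => ?_
      refine ih₂.safe_tagged (isInterp_hVal _) (isInterp_lVal _) (isInterp_lVal _) (closed_num 1)
        ((isInterp_hVal _).mono e₁.2 hw) fun W₂ v' _ hv' => ⟨_, rfl, ?_⟩
      simpa using ⟨⟨1, rfl⟩, hv'⟩
  | prod c₁ c₂ ih₁ ih₂ =>
    rintro W v S ⟨v₁, v₂, h, h₁, h₂⟩
    obtain rfl : v = .arr [v₁, v₂] := h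
    refine ih₁.safe_pair ih₂ (isInterp_hVal _) (isInterp_hVal _) (isInterp_lVal _)
      (isInterp_lVal _) rfl rfl h₁ h₂ fun W' v₁' v₂' hv₁ hv₂ => ⟨_, rfl, ?_⟩
    simpa using ⟨hv₁, hv₂⟩

/-- An array may be too short or carry a tag other than 0 and 1; the code then raises `Conv`, which
the relation allows. Entries beyond the second are dropped. -/
theorem Conv.acts_toHL {τ : HTy} {τ' : LTy} (c : Conv τ τ') : Acts (LVal τ') (HVal τ) c.toHL := by
  induction c with
  | bool => exact .nil fun _ h => h
  | refBool => exact .nil hVal_ref_bool.symm.subset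
  | @sum τ₁ τ₂ c₁ c₂ ih₁ ih₂ =>
    rintro W v S ⟨vs, h, hvs⟩
    obtain rfl : v = .arr vs := h
    refine .run (pureRun_check S vs _) fun W₁ e₁ => ?_
    match vs, hvs with
    | [], _ => exact .fail (.inl rfl)
    | [_], _ => exact .fail (.inl rfl)
    | v₁ :: v₂ :: vs, hvs =>
      obtain ⟨t, ht⟩ := hvs v₁ (by simp)
      obtain rfl : v₁ = .num t := ht
      have hv₂ := hvs v₂ (by simp)
      refine .run ((pureRun_split S (v := .num t) rfl rfl ((isInterp_lVal _).closed hv₂) _).trans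
        ((pureRun_dup _ _ _).tail (pureStep_if0 _ _ _ _ _))) fun W₂ e₂ => ?_
      by_cases h0 : t = 0
      · subst h0
        exact ih₁.safe_tagged (isInterp_lVal _) (isInterp_hVal _) (isInterp_hVal _) (closed_num 0)
          ((isInterp_lVal _).mono (e₁.2.trans e₂.2) hv₂) fun W₂ v' _ hv' => .inl ⟨_, rfl, hv'⟩
      · rw [if_neg h0]
        refine .run ((pureRun_dup _ _ _).trans (.head (pureStep_push _ _ _)
          (.head (pureStep_add _ _ _ _) (.single (pureStep_if0 _ _ _ _ _))))) fun W₃ e₃ => ?_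
        by_cases h1 : t = 1
        · subst h1
          exact ih₂.safe_tagged (isInterp_lVal _) (isInterp_hVal _) (isInterp_hVal _) (closed_num 1)
            ((isInterp_lVal _).mono (e₁.2.trans (e₂.2.trans e₃.2)) hv₂)
            fun W₂ v' _ hv' => .inr ⟨_, rfl, hv'⟩
        -- The second test compares `-1 + t` with zero, and `t ≠ 1`.
        · rw [if_neg (by omega)]
          exact .fail (.inl rfl)
  | prod c₁ c₂ ih₁ ih₂ =>
    rintro W v S ⟨vs, h, hvs⟩
    obtain rfl : v = .arr vs := h
    refine .run (pureRun_check S vs _) fun W₁ e₁ => ?_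
    match vs, hvs with
    | [], _ => exact .fail (.inl rfl)
    | [_], _ => exact .fail (.inl rfl)
    | v₁ :: v₂ :: vs, hvs =>
      exact ih₁.safe_pair ih₂ (isInterp_lVal _) (isInterp_lVal _) (isInterp_hVal _)
        (isInterp_hVal _) rfl rfl ((isInterp_lVal _).mono e₁.2 (hvs v₁ (by simp)))
        ((isInterp_lVal _).mono e₁.2 (hvs v₂ (by simp)))
        fun W' v₁' v₂' hv₁ hv₂ => ⟨_, _, rfl, hv₁, hv₂⟩

-- Closedness of the generated code

theorem fv_swap : SWAP.fv = ∅ := by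
  ext y
  simp only [SWAP, pushTmp, Instr.fv, Val.fv, progFv, Set.mem_sdiff, Set.mem_union,
    Set.mem_singleton_iff, Set.mem_empty_iff_false]
  tauto

theorem fv_dup : DUP.fv = ∅ := by
  simp [DUP, pushTmp, Instr.fv, Val.fv, progFv]

theorem fv_pushNum (n : ℤ) : (pushNum n).fv = ∅ := by
  simp [pushNum, Instr.fv, Val.fv]

theorem Conv.progFv_toLL {τ : HTy} {τ' : LTy} (c : Conv τ τ') : progFv c.toLL = ∅ := by
  induction c <;>
    simp_all [Conv.toLL, progFv, progFv_append, progFv_packArr, fv_swap, fv_dup,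
      fv_pushNum, Instr.fv]

theorem Conv.progFv_toHL {τ : HTy} {τ' : LTy} (c : Conv τ τ') : progFv c.toHL = ∅ := by
  induction c <;>
    simp_all [Conv.toHL, progFv, progFv_append, progFv_packArr, fv_swap, fv_dup,
      fv_pushNum, Instr.fv]

/-! ## Semantic typing of open programs -/

/-- Interpretations of the free variables of a program. -/
abbrev SemEnv := TVar → Option (Set (World × Val))

/-- The substitution `σ` is related at `W` to the semantic environment `Δ`. -/
def EnvRel (Δ : SemEnv) (W : World) (σ : TVar → Option Val) : Prop :=
  ∀ y, Option.Rel (fun R v => (W, v) ∈ R) (Δ y) (σ y)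

/-- All entries of the semantic environment are interpretations. -/
def IsInterpEnv (Δ : SemEnv) : Prop := ∀ y R, Δ y = some R → IsInterp R

section

variable {Δ : SemEnv} {R R' R₁ R₂ : Set (World × Val)} {P P₁ P₂ Q : Prog}

theorem EnvRel.mono (hΔ : IsInterpEnv Δ) {W W' : World} {σ : TVar → Option Val}
    (h : EnvRel Δ W σ) (he : W.Ext W') : EnvRel Δ W' σ := by
  intro y
  have hy := h y
  cases hR : Δ y with
  | none =>
    rw [hR] at hy
    cases hσ : σ y with
    | none => exact .none
    | some v => rw [hσ] at hy; cases hy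
  | some R =>
    rw [hR] at hy
    cases hσ : σ y with
    | none => rw [hσ] at hy; cases hy
    | some v =>
      rw [hσ] at hy
      cases hy with
      | some hv => exact .some ((hΔ y R hR).mono he hv)

theorem EnvRel.closedSubst (hΔ : IsInterpEnv Δ) {W : World} {σ : TVar → Option Val}
    (h : EnvRel Δ W σ) : ClosedSubst σ := by
  intro y v hv
  have hy := h y
  rw [hv] at hy
  cases hR : Δ y with
  | none => rw [hR] at hy; cases hy
  | some R =>
    rw [hR] at hy
    cases hy with
    | some hv => exact (hΔ y R hR).closed hv

theorem EnvRel.eq_none {W : World} {σ : TVar → Option Val} (h : EnvRel Δ W σ) {y : TVar}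
    (hy : σ y = none) : Δ y = none := by
  have h := h y
  rw [hy] at h
  cases hR : Δ y with
  | none => rfl
  | some R => rw [hR] at h; cases h

theorem EnvRel.update {W : World} {σ : TVar → Option Val} (h : EnvRel Δ W σ) (x : TVar) {v : Val}
    (hv : (W, v) ∈ R) :
    EnvRel (Function.update Δ x (some R)) W (Function.update σ x (some v)) := by
  intro y
  by_cases hy : y = x
  · subst hy
    simpa using Option.Rel.some hv
  · simpa [hy] using h y

/-- Semantic typing: the free variables of `P` are declared, and all closings of `P` with related
values evaluate to a value of `R`. -/
structure SemTyped (Δ : SemEnv) (P : Prog) (R : Set (World × Val)) : Prop where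
  fv : ∀ y ∈ progFv P, (Δ y).isSome
  mem : ∀ W σ, EnvRel Δ W σ → (W, progSubst σ P) ∈ ERel R

theorem SemTyped.safe (h : SemTyped Δ P R) {W : World} {σ : TVar → Option Val}
    (hσ : EnvRel Δ W σ) {S : List Val} {Φ : World → List Val → Prop}
    (hQ : ∀ W' v, W.Ext W' → (W', v) ∈ R → Safe Φ W' (v :: S) Q) :
    Safe Φ W S (progSubst σ P ++ Q) :=
  (mem_eRel_iff.1 (h.mem W σ hσ) S).bind fun W' _ he ⟨v, hS, hv⟩ => hS ▸ hQ W' v he hv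

theorem SemTyped.push (hΔ : IsInterpEnv Δ) {v : Val} (hfv : ∀ y ∈ v.fv, (Δ y).isSome)
    (hv : ∀ W σ, EnvRel Δ W σ → (W, v.subst σ) ∈ R) : SemTyped Δ [.push v] R where
  fv y hy := hfv y (by simpa [progFv, Instr.fv] using hy)
  mem W σ hσ := by
    rw [mem_eRel_iff]
    intro S
    simp only [progSubst, Instr.subst]
    exact .of_pureStep (pureStep_push _ _ _) fun W' he => .ret S (hv W' σ (hσ.mono hΔ he.2))

theorem SemTyped.var (hΔ : IsInterpEnv Δ) {x : TVar} (hx : Δ x = some R) :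
    SemTyped Δ [.push (.var x)] R := by
  refine .push hΔ (by simp [Val.fv, hx]) fun W σ hσ => ?_
  have h := hσ x
  rw [hx] at h
  cases hv : σ x with
  | none => rw [hv] at h; cases h
  | some v =>
    rw [hv] at h
    cases h with
    | some h => simpa [Val.subst, hv] using h

theorem SemTyped.num (hΔ : IsInterpEnv Δ) {n : ℤ} (hn : ∀ W, (W, .num n) ∈ R) :
    SemTyped Δ [pushNum n] R :=
  .push hΔ (by simp [Val.fv]) fun W σ _ => by simpa [Val.subst] using hn W

theorem SemTyped.append (h : SemTyped Δ P R) (hQ : progFv Q = ∅) (hA : Acts R R' Q) :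
    SemTyped Δ (P ++ Q) R' where
  fv y hy := h.fv y (by simpa [progFv_append, hQ] using hy)
  mem W σ hσ := by
    rw [mem_eRel_iff]
    intro S
    rw [progSubst_append, progSubst_of_closed hQ]
    exact h.safe hσ fun W' v _ hv => hA W' v S hv

/-- The value of `P₁` waits on the stack while `P₂` runs, and monotonicity of `R₁` carries it to the
later world. -/
theorem SemTyped.append₂ (hΔ : IsInterpEnv Δ) (h₁ : SemTyped Δ P₁ R₁) (h₂ : SemTyped Δ P₂ R₂)
    (hR₁ : IsInterp R₁) (hQ : progFv Q = ∅) (hA : Acts₂ R₁ R₂ R Q) :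
    SemTyped Δ (P₁ ++ P₂ ++ Q) R where
  fv y hy := by
    simp only [progFv_append, hQ, Set.union_empty, Set.mem_union] at hy
    exact hy.elim (h₁.fv y) (h₂.fv y)
  mem W σ hσ := by
    rw [mem_eRel_iff]
    intro S
    rw [progSubst_append, progSubst_append, progSubst_of_closed hQ, List.append_assoc]
    exact h₁.safe hσ fun W₁ v₁ e₁ hv₁ => h₂.safe (hσ.mono hΔ e₁) fun W₂ v₂ e₂ hv₂ =>
      hA W₂ v₁ v₂ S (hR₁.mono e₂ hv₁) hv₂

/-- Serves both conditionals, since `HVal .bool` and `LVal .int` agree by definition. -/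
theorem SemTyped.if0 (hΔ : IsInterpEnv Δ) (h : SemTyped Δ P (LVal .int)) (h₁ : SemTyped Δ P₁ R)
    (h₂ : SemTyped Δ P₂ R) : SemTyped Δ (P ++ [.if0 P₁ P₂]) R where
  fv y hy := by
    simp only [progFv_append, progFv, Instr.fv, Set.union_empty, Set.mem_union] at hy
    exact hy.elim (h.fv y) fun hy => hy.elim (h₁.fv y) (h₂.fv y)
  mem W σ hσ := by
    rw [mem_eRel_iff]
    intro S
    simp only [progSubst_append, progSubst, Instr.subst]
    refine h.safe hσ fun W₁ v e₁ ⟨n, hn⟩ => ?_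
    obtain rfl : v = .num n := hn
    refine .of_pureStep (pureStep_if0 _ _ _ _ _) fun W₂ e₂ => ?_
    have hσ₂ := hσ.mono hΔ (e₁.trans e₂.2)
    rw [List.append_nil]
    split_ifs
    · exact mem_eRel_iff.1 (h₁.mem W₂ σ hσ₂) S
    · exact mem_eRel_iff.1 (h₂.mem W₂ σ hσ₂) S

/-- Closing a body under its binder and then passing the argument amounts to one substitution for
the extended environment. -/
theorem progSubst1_progSubst_erase {σ : TVar → Option Val} (hσ : ClosedSubst σ) (x : TVar)
    (v : Val) (P : Prog) :
    progSubst1 x v (progSubst (substErase σ x) P) = progSubst (Function.update σ x (some v)) P := by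
  rw [progSubst1, progSubst_progSubst (hσ.erase x)]
  congr 1
  funext y
  by_cases hy : y = x
  · subst hy; simp [substComp, substErase]
  · simp [substComp, substErase, hy]

theorem SemTyped.mem_update (hΔ : IsInterpEnv Δ) {x : TVar}
    (h : SemTyped (Function.update Δ x (some R)) P R') {W : World} {σ : TVar → Option Val}
    (hσ : EnvRel Δ W σ) {v : Val} (hv : (W, v) ∈ R) :
    (W, progSubst1 x v (progSubst (substErase σ x) P)) ∈ ERel R' := by
  rw [progSubst1_progSubst_erase (hσ.closedSubst hΔ)]
  exact h.mem _ _ (hσ.update x hv)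

theorem SemTyped.fv_of_update {x : TVar} (h : SemTyped (Function.update Δ x (some R)) P R') :
    ∀ y ∈ progFv P \ {x}, (Δ y).isSome := by
  rintro y ⟨hy, hx : y ≠ x⟩
  simpa [hx] using h.fv y hy

theorem SemTyped.lam (hΔ : IsInterpEnv Δ) {x : TVar}
    (h : SemTyped (Function.update Δ x (some R)) P R') :
    SemTyped Δ [.push (.thunk [.lam x P])] (FnRel R R') := by
  have hfv : ∀ y ∈ (Val.thunk [.lam x P]).fv, (Δ y).isSome := fun y hy =>
    h.fv_of_update y (by simpa [Val.fv, progFv, Instr.fv] using hy)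
  refine .push hΔ hfv fun W σ hσ => ⟨x, progSubst (substErase σ x) P, ?_, ?_, fun v W' e hv => ?_⟩
  · simp [Val.subst, progSubst, Instr.subst]
  · refine Set.eq_empty_of_forall_notMem fun y hy => ?_
    -- A remaining free variable would be declared in `Δ` but not mapped by `σ`, against `EnvRel`.
    obtain ⟨hy, hn⟩ := Val.fv_subst (hσ.closedSubst hΔ) _ y hy
    simpa [hσ.eq_none hn] using hfv y hy
  · exact h.mem_update hΔ (hσ.mono hΔ e.2) hv

theorem SemTyped.case (hΔ : IsInterpEnv Δ) {τ₁ τ₂ : HTy} {x y : TVar}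
    (h : SemTyped Δ P (HVal (.sum τ₁ τ₂)))
    (h₁ : SemTyped (Function.update Δ x (some (HVal τ₁))) P₁ R)
    (h₂ : SemTyped (Function.update Δ y (some (HVal τ₂))) P₂ R) :
    SemTyped Δ (P ++ [DUP, pushNum 1, .idx, SWAP, pushNum 0, .idx,
      .if0 [.lam x P₁] [.lam y P₂]]) R where
  fv z hz := by
    simp only [progFv_append, progFv, Instr.fv, fv_dup, fv_swap, fv_pushNum, Set.union_empty,
      Set.empty_union, Set.mem_union] at hz
    exact hz.elim (h.fv z) fun hz => hz.elim (h₁.fv_of_update z) (h₂.fv_of_update z)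
  mem W σ hσ := by
    have hd : DUP.subst σ = DUP := Instr.subst_of_fv _ (by simp [fv_dup])
    have hs : SWAP.subst σ = SWAP := Instr.subst_of_fv _ (by simp [fv_swap])
    have hp (n : ℤ) : (pushNum n).subst σ = pushNum n := by
      simp [pushNum, Instr.subst, Val.subst]
    rw [mem_eRel_iff]
    intro S
    simp only [progSubst_append, progSubst, hd, hs, hp]
    simp only [Instr.subst, progSubst]
    refine h.safe hσ fun W₁ v e₁ hv => ?_
    rcases hv with ⟨w, h, hw⟩ | ⟨w, h, hw⟩
    · obtain rfl : v = .arr [.num 0, w] := h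
      refine .run ((pureRun_split S (v := .num 0) rfl rfl ((isInterp_hVal _).closed hw) _).tail
        (pureStep_if0 _ _ _ _ _) |>.tail (pureStep_lam _ _ _ _ _)) fun W₂ e₂ => ?_
      -- The test on the literal tag computes, so the continuation left after the branch is empty.
      change Safe _ _ _ (_ ++ [])
      rw [List.append_nil]
      exact mem_eRel_iff.1 (h₁.mem_update hΔ (hσ.mono hΔ (e₁.trans e₂.2))
        ((isInterp_hVal _).mono e₂.2 hw)) S
    · obtain rfl : v = .arr [.num 1, w] := h
      refine .run ((pureRun_split S (v := .num 1) rfl rfl ((isInterp_hVal _).closed hw) _).tail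
        (pureStep_if0 _ _ _ _ _) |>.tail (pureStep_lam _ _ _ _ _)) fun W₂ e₂ => ?_
      change Safe _ _ _ (_ ++ [])
      rw [List.append_nil]
      exact mem_eRel_iff.1 (h₂.mem_update hΔ (hσ.mono hΔ (e₁.trans e₂.2))
        ((isInterp_hVal _).mono e₂.2 hw)) S

/-- Semantic typing of code that pushes `n` values of `R`. -/
structure SemTypedList (Δ : SemEnv) (P : Prog) (n : ℕ) (R : Set (World × Val)) : Prop where
  fv : ∀ y ∈ progFv P, (Δ y).isSome
  safe : ∀ W σ S, EnvRel Δ W σ → Safe (fun W' S' => ∃ vs : List Val, vs.length = n ∧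
    S' = vs.reverse ++ S ∧ ∀ v ∈ vs, (W', v) ∈ R) W S (progSubst σ P)

theorem SemTypedList.nil : SemTypedList Δ [] 0 R where
  fv y hy := by simp [progFv] at hy
  safe W σ S _ := by
    rw [progSubst]
    exact .nil ⟨[], rfl, rfl, by simp⟩

theorem SemTypedList.cons (hΔ : IsInterpEnv Δ) (hR : IsInterp R) {n : ℕ} (h : SemTyped Δ P R)
    (hs : SemTypedList Δ Q n R) : SemTypedList Δ (P ++ Q) (n + 1) R where
  fv y hy := by
    simp only [progFv_append, Set.mem_union] at hy
    exact hy.elim (h.fv y) (hs.fv y)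
  safe W σ S hσ := by
    rw [progSubst_append]
    refine h.safe hσ fun W₁ v e₁ hv => ?_
    rw [← List.append_nil (progSubst σ Q)]
    refine (hs.safe W₁ σ (v :: S) (hσ.mono hΔ e₁)).bind fun W₂ S₂ e₂ ⟨vs, hn, hS, hvs⟩ => .nil ?_
    exact ⟨v :: vs, by simp [hn], by simp [hS], by simpa using ⟨hR.mono e₂ hv, hvs⟩⟩

theorem SemTypedList.arr {τ : LTy} {n : ℕ} (h : SemTypedList Δ P n (LVal τ)) :
    SemTyped Δ (P ++ packArr n) (LVal (.arr τ)) where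
  fv y hy := h.fv y (by simpa [progFv_append, progFv_packArr] using hy)
  mem W σ hσ := by
    rw [mem_eRel_iff]
    intro S
    rw [progSubst_append, progSubst_of_closed (progFv_packArr n)]
    refine (h.safe W σ S hσ).bind fun W₁ S₁ e₁ ⟨vs, hn, hS, hvs⟩ => ?_
    subst hn hS
    rw [← List.append_nil (packArr _)]
    refine .run (pureRun_packArr S (fun v hv => (isInterp_lVal τ).closed (hvs v hv)) [])
      fun W₂ e₂ => .ret S ?_
    exact ⟨vs, rfl, fun v hv => (isInterp_lVal τ).mono e₂.2 (hvs v hv)⟩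

/-! ## The code of the elimination and introduction forms -/

theorem acts_tag (hR : IsInterp R) {t : ℤ}
    (h : ∀ W v, (W, v) ∈ R → (W, .arr [.num t, v]) ∈ R') :
    Acts R R' [.lam (.tmp 0) [.push (.arr [.num t, .var (.tmp 0)])]] := by
  intro W v S hv
  refine .of_pureStep (pureStep_lam _ _ _ _ _) fun W₁ e₁ => ?_
  simp only [progSubst1, progSubst, Instr.subst, Val.subst, valsSubst, if_true, Option.getD_some,
    List.append_nil]
  refine .of_pureStep (pureStep_push _ _ _) fun W₂ e₂ => .ret S ?_
  exact h W₂ v (hR.mono (e₁.2.trans e₂.2) hv)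

theorem progFv_tag (t : ℤ) :
    progFv [.lam (.tmp 0) [.push (.arr [.num t, .var (.tmp 0)])]] = ∅ := by
  simp [progFv, Instr.fv, Val.fv, valsFv]

theorem acts_fst (τ₁ τ₂ : HTy) : Acts (HVal (.prod τ₁ τ₂)) (HVal τ₁) [pushNum 0, .idx] := by
  rintro W v S ⟨v₁, v₂, h, h₁, -⟩
  obtain rfl : v = .arr [v₁, v₂] := h
  exact .run (pureRun_push_idx S _ (n := 0) rfl _) fun W₁ e₁ =>
    .ret S ((isInterp_hVal _).mono e₁.2 h₁)

theorem acts_snd (τ₁ τ₂ : HTy) : Acts (HVal (.prod τ₁ τ₂)) (HVal τ₂) [pushNum 1, .idx] := by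
  rintro W v S ⟨v₁, v₂, h, -, h₂⟩
  obtain rfl : v = .arr [v₁, v₂] := h
  exact .run (pureRun_push_idx S _ (n := 1) rfl _) fun W₁ e₁ =>
    .ret S ((isInterp_hVal _).mono e₁.2 h₂)

theorem acts_pair (τ₁ τ₂ : HTy) : Acts₂ (HVal τ₁) (HVal τ₂) (HVal (.prod τ₁ τ₂)) (packArr 2) :=
  fun _ v₁ v₂ _ h₁ h₂ =>
    safe_packArr_two ((isInterp_hVal _).closed h₁) ((isInterp_hVal _).closed h₂) fun _ e =>
      ⟨v₁, v₂, rfl, (isInterp_hVal _).mono e.2 h₁, (isInterp_hVal _).mono e.2 h₂⟩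

/-- Function values promise something only in strictly later worlds, and the steps of `SWAP`, `call`
and `lam` reach one. -/
theorem acts_app (hR : IsInterp R) : Acts₂ (FnRel R R') R R' [SWAP, .call] := by
  rintro W v₁ v₂ S ⟨x, P, h, -, hP⟩ h₂
  obtain rfl : v₁ = .thunk [.lam x P] := h
  refine .run ((pureRun_swap S (hR.closed h₂) _ _).tail (pureStep_call _ _ _) |>.tail
    (pureStep_lam _ _ _ _ _)) fun W₁ e₁ => ?_
  change Safe _ _ _ (_ ++ [])
  rw [List.append_nil]
  exact mem_eRel_iff.1 (hP v₂ W₁ e₁ (hR.mono e₁.2 h₂)) S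

theorem acts_add : Acts₂ (LVal .int) (LVal .int) (LVal .int) [SWAP, .add] := by
  rintro W v₁ v₂ S ⟨n, h⟩ ⟨m, h'⟩
  obtain rfl : v₁ = .num n := h
  obtain rfl : v₂ = .num m := h'
  exact .run ((pureRun_swap S (closed_num m) _ _).tail (pureStep_add _ _ _ _)) fun W₁ _ =>
    .ret S ⟨_, rfl⟩

theorem acts_index (τ : LTy) : Acts₂ (LVal (.arr τ)) (LVal .int) (LVal τ) [.idx] := by
  rintro W v₁ v₂ S ⟨vs, h, hvs⟩ ⟨m, h'⟩
  obtain rfl : v₁ = .arr vs := h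
  obtain rfl : v₂ = .num m := h'
  by_cases hm : 0 ≤ m ∧ m < (vs.length : ℤ)
  · lift m to ℕ using hm.1
    have hl : m < vs.length := by exact_mod_cast hm.2
    exact .of_pureStep (pureStep_idx S vs (List.getElem?_eq_getElem hl) _) fun W₁ e₁ =>
      .ret S ((isInterp_lVal τ).mono e₁.2 (hvs _ (List.getElem_mem hl)))
  -- An index out of bounds raises `Idx`, an allowed error.
  · exact .of_pureStep (pureStep_idx_fail S vs hm _) fun W₁ _ => .fail (.inr rfl)

theorem acts_alloc (hR : IsInterp R) : Acts R (RefRel R) [.alloc] :=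
  fun _ _ S hv => .alloc hR hv fun _ _ _ hl => .ret S hl

theorem acts_read : Acts (RefRel R) R [.read] := by
  rintro W v S ⟨l, h, hl⟩
  obtain rfl : v = .loc l := h
  exact .read ⟨l, rfl, hl⟩ fun _ _ _ hv => .ret S hv

/-- The result relation is left open because the pushed 0 is read as the unit value by RefHL and as
an integer by RefLL. -/
theorem acts_write (hR : IsInterp R) (hR' : ∀ W, (W, .num 0) ∈ R') :
    Acts₂ (RefRel R) R R' [.write, pushNum 0] := by
  rintro W v₁ v₂ S ⟨l, h, hl⟩ hv
  obtain rfl : v₁ = .loc l := h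
  exact .write hR ⟨l, rfl, hl⟩ hv fun W₁ _ =>
    .of_pureStep (pureStep_push _ _ _) fun W₂ _ => .ret S (hR' W₂)

end

/-! ## The fundamental property -/

/-- The semantic environment of a pair of type environments. -/
def semEnv (ΓH : Env HTy) (ΓL : Env LTy) : SemEnv
  | .hl x => (ΓH.lookup x).map HVal
  | .ll x => (ΓL.lookup x).map LVal
  | .tmp _ => none

theorem isInterpEnv_semEnv (ΓH : Env HTy) (ΓL : Env LTy) : IsInterpEnv (semEnv ΓH ΓL) := by
  intro y R h
  cases y with
  | hl x =>
    obtain ⟨τ, -, rfl⟩ := Option.map_eq_some_iff.1 h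
    exact isInterp_hVal τ
  | ll x =>
    obtain ⟨τ, -, rfl⟩ := Option.map_eq_some_iff.1 h
    exact isInterp_lVal τ
  | tmp i => cases h

theorem semEnv_cons_left (ΓH : Env HTy) (ΓL : Env LTy) (x : ℕ) (τ : HTy) :
    semEnv ((x, τ) :: ΓH) ΓL = Function.update (semEnv ΓH ΓL) (.hl x) (some (HVal τ)) := by
  funext y
  rcases y with y | y | y
  · by_cases h : y = x
    · subst h; simp [semEnv]
    · have : (y == x) = false := by simpa using h
      simp [semEnv, List.lookup_cons, h, this]
  · simp [semEnv]
  · simp [semEnv]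

theorem semEnv_cons_right (ΓH : Env HTy) (ΓL : Env LTy) (x : ℕ) (τ : LTy) :
    semEnv ΓH ((x, τ) :: ΓL) = Function.update (semEnv ΓH ΓL) (.ll x) (some (LVal τ)) := by
  funext y
  rcases y with y | y | y
  · simp [semEnv]
  · by_cases h : y = x
    · subst h; simp [semEnv]
    · have : (y == x) = false := by simpa using h
      simp [semEnv, List.lookup_cons, h, this]
  · simp [semEnv]

-- The semantic environment does not depend on the language of the expression, so crossing a
-- boundary keeps it and only appends closed conversion code.
mutual
  theorem HTyping.semTyped : {ΓL : Env LTy} → {ΓH : Env HTy} → {e : HExp} → {τ : HTy} →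
      (d : HTyping ΓL ΓH e τ) → SemTyped (semEnv ΓH ΓL) d.compile (HVal τ)
    | ΓL, ΓH, _, _, .unit => by
        rw [HTyping.compile]; exact .num (isInterpEnv_semEnv _ _) fun _ => rfl
    | ΓL, ΓH, _, _, .true => by
        rw [HTyping.compile]; exact .num (isInterpEnv_semEnv _ _) fun _ => ⟨_, rfl⟩
    | ΓL, ΓH, _, _, .false => by
        rw [HTyping.compile]; exact .num (isInterpEnv_semEnv _ _) fun _ => ⟨_, rfl⟩
    | ΓL, ΓH, _, _, .var h => by
        rw [HTyping.compile]; exact .var (isInterpEnv_semEnv _ _) (by simp [semEnv, h])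
    | ΓL, ΓH, _, _, .inl d => by
        rw [HTyping.compile]
        exact d.semTyped.append (progFv_tag 0)
          (acts_tag (isInterp_hVal _) fun _ v hv => .inl ⟨v, rfl, hv⟩)
    | ΓL, ΓH, _, _, .inr d => by
        rw [HTyping.compile]
        exact d.semTyped.append (progFv_tag 1)
          (acts_tag (isInterp_hVal _) fun _ v hv => .inr ⟨v, rfl, hv⟩)
    | ΓL, ΓH, _, _, .pair d₁ d₂ => by
        rw [HTyping.compile]
        exact d₁.semTyped.append₂ (isInterpEnv_semEnv _ _) d₂.semTyped (isInterp_hVal _)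
          (progFv_packArr 2) (acts_pair _ _)
    | ΓL, ΓH, _, _, .fst d => by
        rw [HTyping.compile]
        exact d.semTyped.append (by simp [progFv, Instr.fv, fv_pushNum]) (acts_fst _ _)
    | ΓL, ΓH, _, _, .snd d => by
        rw [HTyping.compile]
        exact d.semTyped.append (by simp [progFv, Instr.fv, fv_pushNum]) (acts_snd _ _)
    | ΓL, ΓH, _, _, .ite d d₁ d₂ => by
        rw [HTyping.compile]
        exact .if0 (isInterpEnv_semEnv _ _) d.semTyped d₁.semTyped d₂.semTyped
    | ΓL, ΓH, _, _, .lam d => by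
        rw [HTyping.compile]
        exact .lam (isInterpEnv_semEnv _ _) (semEnv_cons_left _ _ _ _ ▸ d.semTyped)
    | ΓL, ΓH, _, _, .app d₁ d₂ => by
        rw [HTyping.compile]
        exact d₁.semTyped.append₂ (isInterpEnv_semEnv _ _) d₂.semTyped (isInterp_hVal _)
          (by simp [progFv, Instr.fv, fv_swap]) (acts_app (isInterp_hVal _))
    | ΓL, ΓH, _, _, .case d d₁ d₂ => by
        rw [HTyping.compile]
        exact .case (isInterpEnv_semEnv _ _) d.semTyped (semEnv_cons_left _ _ _ _ ▸ d₁.semTyped)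
          (semEnv_cons_left _ _ _ _ ▸ d₂.semTyped)
    | ΓL, ΓH, _, _, .ref d => by
        rw [HTyping.compile]
        exact d.semTyped.append (by simp [progFv, Instr.fv]) (acts_alloc (isInterp_hVal _))
    | ΓL, ΓH, _, _, .deref d => by
        rw [HTyping.compile]
        exact d.semTyped.append (by simp [progFv, Instr.fv]) acts_read
    | ΓL, ΓH, _, _, .assign d₁ d₂ => by
        rw [HTyping.compile]
        exact d₁.semTyped.append₂ (isInterpEnv_semEnv _ _) d₂.semTyped (isInterp_hVal (.ref _))
          (by simp [progFv, Instr.fv, fv_pushNum]) (acts_write (isInterp_hVal _) fun _ => rfl)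
    | ΓL, ΓH, _, _, .boundary d c => by
        rw [HTyping.compile]
        exact d.semTyped.append c.progFv_toHL c.acts_toHL
  theorem LTyping.semTyped : {ΓH : Env HTy} → {ΓL : Env LTy} → {e : LExp} → {τ : LTy} →
      (d : LTyping ΓH ΓL e τ) → SemTyped (semEnv ΓH ΓL) d.compile (LVal τ)
    | ΓH, ΓL, _, _, .num => by
        rw [LTyping.compile]; exact .num (isInterpEnv_semEnv _ _) fun _ => ⟨_, rfl⟩
    | ΓH, ΓL, _, _, .var h => by
        rw [LTyping.compile]; exact .var (isInterpEnv_semEnv _ _) (by simp [semEnv, h])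
    | ΓH, ΓL, _, _, .arr ds => by
        rw [LTyping.compile]; exact ds.semTyped.arr
    | ΓH, ΓL, _, _, .index d₁ d₂ => by
        rw [LTyping.compile]
        exact d₁.semTyped.append₂ (isInterpEnv_semEnv _ _) d₂.semTyped (isInterp_lVal (.arr _))
          (by simp [progFv, Instr.fv]) (acts_index _)
    | ΓH, ΓL, _, _, .lam d => by
        rw [LTyping.compile]
        exact .lam (isInterpEnv_semEnv _ _) (semEnv_cons_right _ _ _ _ ▸ d.semTyped)
    | ΓH, ΓL, _, _, .app d₁ d₂ => by
        rw [LTyping.compile]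
        exact d₁.semTyped.append₂ (isInterpEnv_semEnv _ _) d₂.semTyped (isInterp_lVal _)
          (by simp [progFv, Instr.fv, fv_swap]) (acts_app (isInterp_lVal _))
    | ΓH, ΓL, _, _, .add d₁ d₂ => by
        rw [LTyping.compile]
        exact d₁.semTyped.append₂ (isInterpEnv_semEnv _ _) d₂.semTyped (isInterp_lVal .int)
          (by simp [progFv, Instr.fv, fv_swap]) acts_add
    | ΓH, ΓL, _, _, .if0 d d₁ d₂ => by
        rw [LTyping.compile]
        exact .if0 (isInterpEnv_semEnv _ _) d.semTyped d₁.semTyped d₂.semTyped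
    | ΓH, ΓL, _, _, .ref d => by
        rw [LTyping.compile]
        exact d.semTyped.append (by simp [progFv, Instr.fv]) (acts_alloc (isInterp_lVal _))
    | ΓH, ΓL, _, _, .deref d => by
        rw [LTyping.compile]
        exact d.semTyped.append (by simp [progFv, Instr.fv]) acts_read
    | ΓH, ΓL, _, _, .assign d₁ d₂ => by
        rw [LTyping.compile]
        exact d₁.semTyped.append₂ (isInterpEnv_semEnv _ _) d₂.semTyped (isInterp_lVal (.ref _))
          (by simp [progFv, Instr.fv, fv_pushNum])
          (acts_write (isInterp_lVal _) fun _ => ⟨_, rfl⟩)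
    | ΓH, ΓL, _, _, .boundary d c => by
        rw [LTyping.compile]
        exact d.semTyped.append c.progFv_toLL c.acts_toLL
  theorem LTypings.semTyped : {ΓH : Env HTy} → {ΓL : Env LTy} → {es : List LExp} → {τ : LTy} →
      (ds : LTypings ΓH ΓL es τ) → SemTypedList (semEnv ΓH ΓL) ds.compile es.length (LVal τ)
    | _, _, _, _, .nil => by rw [LTypings.compile]; exact .nil
    | _, _, _, _, .cons d ds => by
        rw [LTypings.compile]
        exact .cons (isInterpEnv_semEnv _ _) (isInterp_lVal _) d.semTyped ds.semTyped
end

/-- The joint substitution for the variables of both languages. -/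
def joinSubst (γH γL : ℕ → Option Val) : TVar → Option Val
  | .hl x => γH x
  | .ll x => γL x
  | .tmp _ => none

theorem GRel.rel_map {Ty : Type} {V : Ty → Set (World × Val)} {Γ : Env Ty} {W : World}
    {γ : ℕ → Option Val} (h : (W, γ) ∈ GRel V Γ) (x : ℕ) :
    Option.Rel (fun R v => (W, v) ∈ R) ((Γ.lookup x).map V) (γ x) := by
  have hx : Option.Rel (fun τ v => (W, v) ∈ V τ) (Γ.lookup x) (γ x) := h x
  generalize Γ.lookup x = o, γ x = o' at hx ⊢
  cases hx with
  | none => exact .none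
  | some hv => exact .some hv

theorem envRel_joinSubst {ΓH : Env HTy} {ΓL : Env LTy} {W : World} {γH γL : ℕ → Option Val}
    (hH : (W, γH) ∈ GRel HVal ΓH) (hL : (W, γL) ∈ GRel LVal ΓL) :
    EnvRel (semEnv ΓH ΓL) W (joinSubst γH γL)
  | .hl x => GRel.rel_map hH x
  | .ll x => GRel.rel_map hL x
  | .tmp _ => .none

/-- The two substitutions act on disjoint families of variables and have closed values, so their
order is immaterial. -/
theorem closeH_closeL {γH γL : ℕ → Option Val} (h : ClosedSubst (joinSubst γH γL)) (P : Prog) :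
    closeH γH (closeL γL P) = progSubst (joinSubst γH γL) P := by
  rw [closeH, closeL, progSubst_progSubst]
  · congr 1
    funext y
    cases y <;> simp [substComp, joinSubst]
  · intro y v hy
    cases y with
    | ll x => exact h (.ll x) v hy
    | hl x => cases hy
    | tmp i => cases hy

theorem closeL_closeH {γH γL : ℕ → Option Val} (h : ClosedSubst (joinSubst γH γL)) (P : Prog) :
    closeL γL (closeH γH P) = progSubst (joinSubst γH γL) P := by
  rw [closeH, closeL, progSubst_progSubst]
  · congr 1
    funext y
    cases y <;> simp [substComp, joinSubst]
  · intro y v hy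
    cases y with
    | hl x => exact h (.hl x) v hy
    | ll x => cases hy
    | tmp i => cases hy

end RefInterop

theorem theorem3p2 :
    (∀ (ΓH : RefInterop.Env RefInterop.HTy) (ΓL : RefInterop.Env RefInterop.LTy)
        (e : RefInterop.LExp) (τ : RefInterop.LTy) (d : RefInterop.LTyping ΓH ΓL e τ),
      RefInterop.LSem ΓH ΓL d.compile τ) ∧
    (∀ (ΓL : RefInterop.Env RefInterop.LTy) (ΓH : RefInterop.Env RefInterop.HTy)
        (e : RefInterop.HExp) (τ : RefInterop.HTy) (d : RefInterop.HTyping ΓL ΓH e τ),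
      RefInterop.HSem ΓL ΓH d.compile τ) := by
  constructor
  · intro ΓH ΓL e τ d W γH γL hH hL
    have hσ := RefInterop.envRel_joinSubst hH hL
    rw [RefInterop.closeH_closeL (hσ.closedSubst (RefInterop.isInterpEnv_semEnv ΓH ΓL))]
    exact d.semTyped.mem W _ hσ
  · intro ΓL ΓH e τ d W γL γH hL hH
    have hσ := RefInterop.envRel_joinSubst hH hL
    rw [RefInterop.closeL_closeH (hσ.closedSubst (RefInterop.isInterpEnv_semEnv ΓH ΓL))]
    exact d.semTyped.mem W _ hσ
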